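/- Let $\mathcal Y$ be the space of all vector fields $A\in L^3(\mathbb R^3,\mathbb R^3)$ whose distributional curl $\nabla\wedge A$ belongs to $L^{3/2}(\mathbb R^3,\mathbb R^3)$. For $A\in\mathcal Y$ put $$ |\!|\!| A |\!|\!|_3 := \inf_{\phi\in\dot W^{1,3}(\mathbb R^3)} \|A-\nabla\phi\|_{L^3}, $$ where $\dot W^{1,3}(\mathbb R^3)$ is the space of all real functions $\phi\in L^1_{\rm loc}(\mathbb R^3)$ whose distributional gradient satisfies $\nabla\phi\in L^3(\mathbb R^3,\mathbb R^3)$. For $t>0$ let $e^{t\Delta}$ be the heat semigroup, $(e^{t\Delta}B)(x)=(4\pi t)^{-3/2}\int_{\mathbb R^3} e^{-|x-y|^2/(4t)}B(y)\,dy$. Then there is a universal constant $C<\infty$ such that for every $A\in\mathcal Y$ $$ |\!|\!| A |\!|\!|_3 \le C\, \|\nabla\wedge A\|_{L^{3/2}}^{1/2} \Bigl( \sup_{t>0} t\, \|e^{t\Delta}(\nabla\wedge A)\|_{L^\infty(\mathbb R^3,\mathbb R^3)} \Bigr)^{1/2}. $$ -/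

import Mathlib

open MeasureTheory
open scoped ENNReal NNReal ContDiff

/-- Three-dimensional Euclidean space. -/
abbrev R3 : Type := EuclideanSpace ℝ (Fin 3)

/-- The partial derivative `∂ᵢ ψ`. -/
noncomputable def partialDeriv (i : Fin 3) (ψ : R3 → ℝ) (x : R3) : ℝ :=
  fderiv ℝ ψ x (EuclideanSpace.single i 1)

/-- Real-valued test functions: smooth with compact support. -/
def IsTestFunction (ψ : R3 → ℝ) : Prop :=
  ContDiff ℝ ∞ ψ ∧ HasCompactSupport ψ

/-- The locally integrable field `G` is the distributional gradient of `φ ∈ L¹_loc`. -/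
def HasWeakGradient (φ : R3 → ℝ) (G : R3 → R3) : Prop :=
  LocallyIntegrable φ volume ∧ LocallyIntegrable G volume ∧
    ∀ ψ : R3 → ℝ, IsTestFunction ψ → ∀ i : Fin 3,
      ∫ x, G x i * ψ x = - ∫ x, φ x * partialDeriv i ψ x

/-- The locally integrable field `B` is the distributional curl of `A ∈ L¹_loc`, that is,
`Bᵢ = ∂ᵢ₊₁ Aᵢ₊₂ - ∂ᵢ₊₂ Aᵢ₊₁` in the sense of distributions, with indices modulo 3. -/
def HasWeakCurl (A B : R3 → R3) : Prop :=
  LocallyIntegrable A volume ∧ LocallyIntegrable B volume ∧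
    ∀ ψ : R3 → ℝ, IsTestFunction ψ → ∀ i : Fin 3,
      ∫ x, B x i * ψ x =
        - ∫ x, (A x (i + 2) * partialDeriv (i + 1) ψ x
          - A x (i + 1) * partialDeriv (i + 2) ψ x)

/-- The vector fields in `L³` whose distributional curl is in `L^{3/2}`. -/
def spaceY : Set (R3 → R3) :=
  {A | MemLp A 3 volume ∧ ∃ B : R3 → R3, MemLp B (3 / 2) volume ∧ HasWeakCurl A B}

/-- The infimum of `‖A - ∇φ‖₃` over all real `φ ∈ L¹_loc` with `∇φ ∈ L³`. -/
noncomputable def gaugeL3Seminorm (A : R3 → R3) : ℝ≥0∞ :=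
  ⨅ (φ : R3 → ℝ) (G : R3 → R3) (_ : HasWeakGradient φ G) (_ : MemLp G 3 volume),
    eLpNorm (fun x => A x - G x) 3 volume

/-- The heat semigroup `e^{tΔ}`, `t > 0`, as convolution with the Gaussian kernel. -/
noncomputable def heatSemigroup (t : ℝ) (B : R3 → R3) (x : R3) : R3 :=
  ∫ y, ((4 * Real.pi * t) ^ (-(3 / 2) : ℝ) * Real.exp (-‖x - y‖ ^ 2 / (4 * t))) • B y

/-- `sup_{t > 0} t ‖e^{tΔ} B‖_∞`. -/
noncomputable def heatBesovNorm (B : R3 → R3) : ℝ≥0∞ :=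
  ⨆ (t : ℝ) (_ : 0 < t), ENNReal.ofReal t * eLpNorm (heatSemigroup t B) ∞ volume

/-! Write `B` for the curl of `A` and `K` for the heat norm of `B`. For `0 < ε ≤ T` the heat
equation gives `e^{εΔ}A - e^{TΔ}A = -∫_ε^T Δ e^{tΔ}A dt`, and `-Δ = curl curl - ∇ div` turns the
right side into `∫_ε^T curl e^{tΔ}B dt` plus the gradient of `φ = -∫_ε^T div e^{tΔ}A dt`. This `φ`
is the competitor in the infimum. Since `A - e^{εΔ}A` and `e^{TΔ}A` vanish in `L³` as `ε → 0` and `T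
→ ∞`, it remains to bound the curl part in `L³` uniformly in `ε` and `T`. Truncating to `[ε, T]`
avoids singular integrals: every kernel has Gaussian decay, so Fubini applies throughout and `∇φ ∈
L³` follows from Young's inequality.

The curl part is handled as in Hedberg's inequality. Pointwise, `|∂ⱼ e^{tΔ}B|` is at most `3
t^{-1/2} M|B|(x)`, with `M` the maximal function, and, since `e^{tΔ}` factors through `e^{tΔ/2}`,
also at most `9 t^{-3/2} K`. Using the first bound for small `t` and the second for large `t`, with
the best splitting time, gives `∫₀^∞ |∂ⱼ e^{tΔ}B| dt ≤ 24 (M|B|(x) K)^{1/2}`. Cubing and integrating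
leaves `K^{3/2} ∫ (M|B|)^{3/2}`, which the `L^{3/2}` maximal inequality bounds by a multiple of
`K^{3/2} ∫ |B|^{3/2}`.

The main lemmas are `lintegral_rpow_le_of_le_hlMaximal` (maximal inequality),
`lintegral_Ioi_le_geometric_mean` (optimization in time), `heatCurlPart_apply` (double-curl
identity), `eLpNorm_heatCurlPart_le` (uniform bound) and `gaugeL3Seminorm_le` (decomposition). -/

open Metric Set

/-! ### The maximal function and its `L^{3/2}` bound -/

/-- The centred Hardy–Littlewood maximal function on `ℝ³`. -/
noncomputable def hlMaximal (f : R3 → ℝ≥0∞) (x : R3) : ℝ≥0∞ :=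
  ⨆ (r : ℝ) (_ : 0 < r), (∫⁻ y in ball x r, f y) / volume (ball x r)

lemma setLIntegral_ball_le_hlMaximal (f : R3 → ℝ≥0∞) (x : R3) {r : ℝ} (hr : 0 < r) :
    ∫⁻ y in ball x r, f y ≤ hlMaximal f x * volume (ball x r) := by
  rw [← ENNReal.div_le_iff (measure_ball_pos volume x hr).ne' measure_ball_lt_top.ne]
  exact le_iSup₂_of_le r hr le_rfl

lemma volume_ball_R3_mul (x y : R3) {s : ℝ} (hs : 0 < s) (r : ℝ) :
    volume (ball x (s * r)) = ENNReal.ofReal (s ^ 3) * volume (ball y r) := by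
  rw [Measure.addHaar_ball_mul_of_pos _ _ hs, Measure.addHaar_ball_center volume y]
  simp

/-- The weak type (1,1) bound for the maximal function. -/
lemma volume_lt_hlMaximal_le (f : R3 → ℝ≥0∞) {a : ℝ≥0∞} (ha : a ≠ 0) (ha' : a ≠ ⊤) :
    volume {x | a < hlMaximal f x} ≤ 64 / a * ∫⁻ x, f x := by
  rcases eq_or_ne (∫⁻ x, f x) ⊤ with h | hfin
  · rw [h, ENNReal.mul_top]
    · exact le_top
    · simp [ENNReal.div_eq_zero_iff, ha']
  have key : ∀ x : {x | a < hlMaximal f x}, ∃ r : ℝ, 0 < r ∧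
      a * volume (ball (x : R3) r) ≤ ∫⁻ y in ball (x : R3) r, f y := by
    rintro ⟨x, hx⟩
    have hx' : a < hlMaximal f x := hx
    unfold hlMaximal at hx'
    obtain ⟨r, hr⟩ := lt_iSup_iff.1 hx'
    obtain ⟨hr0, hr⟩ := lt_iSup_iff.1 hr
    refine ⟨r, hr0, ?_⟩
    exact (ENNReal.le_div_iff_mul_le (Or.inl (measure_ball_pos volume x hr0).ne')
      (Or.inl measure_ball_lt_top.ne)).1 hr.le
  choose r hr0 hr using key
  set v := volume (ball (0 : R3) 1) with hv
  have hv0 : v ≠ 0 := (measure_ball_pos volume _ one_pos).ne'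
  have hvt : v ≠ ⊤ := measure_ball_lt_top.ne
  -- Vitali's lemma needs bounded radii. When `r > 1`, `r ≤ r³`, and `r³` is controlled by the total
  -- mass of `f` divided by `a * v`.
  have hbd : ∀ x ∈ (univ : Set {x | a < hlMaximal f x}),
      r x ≤ max 1 ((∫⁻ y, f y) / (a * v)).toReal := by
    intro x _
    by_contra! hlt
    obtain ⟨h1, h2⟩ := max_lt_iff.1 hlt
    have h3 : a * volume (ball (x : R3) (r x)) ≤ ∫⁻ y, f y :=
      (hr x).trans (setLIntegral_le_lintegral _ _)
    have h4 := volume_ball_R3_mul (x : R3) 0 (hr0 x) 1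
    rw [mul_one] at h4
    rw [h4, ← hv, mul_left_comm, ← ENNReal.le_div_iff_mul_le
      (Or.inl (mul_ne_zero ha hv0)) (Or.inl (ENNReal.mul_ne_top ha' hvt))] at h3
    have h5 : (∫⁻ y, f y) / (a * v) ≠ ⊤ := ENNReal.div_ne_top hfin (mul_ne_zero ha hv0)
    have h6 := (ENNReal.ofReal_le_iff_le_toReal h5).1 h3
    have h7 : r x ≤ r x ^ 3 := by nlinarith [mul_pos (hr0 x) (hr0 x)]
    linarith
  -- Any enlargement factor above 3 would do; the factor 4 produces the constant `64 = 4³`.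
  obtain ⟨u, -, hdisj, hcov⟩ := Vitali.exists_disjoint_subfamily_covering_enlargement_ball
    (univ : Set {x | a < hlMaximal f x}) (fun x => (x : R3)) r _ hbd 4 (by norm_num)
  have hcount : u.Countable := hdisj.countable_of_isOpen (fun _ _ => isOpen_ball)
    (fun x _ => ⟨x, mem_ball_self (hr0 x)⟩)
  have hsub : {x | a < hlMaximal f x} ⊆ ⋃ b ∈ u, ball (b : R3) (4 * r b) := by
    intro x hx
    obtain ⟨b, hb, hb'⟩ := hcov ⟨x, hx⟩ (mem_univ _)
    exact mem_biUnion hb (hb' (mem_ball_self (hr0 _)))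
  have := hcount.to_subtype
  calc volume {x | a < hlMaximal f x} ≤ ∑' b : u, volume (ball ((b : {x | a < hlMaximal f x}) : R3)
          (4 * r b)) := (measure_mono hsub).trans (measure_biUnion_le _ hcount _)
    _ ≤ ∑' b : u, 64 / a * ∫⁻ y in ball ((b : {x | a < hlMaximal f x}) : R3) (r b), f y := by
        refine ENNReal.tsum_le_tsum fun b => ?_
        rw [volume_ball_R3_mul _ (b : R3) (by norm_num)]
        have : ENNReal.ofReal (4 ^ 3) = 64 := by norm_num
        rw [this, div_eq_mul_inv, mul_assoc, mul_comm a⁻¹, ← div_eq_mul_inv]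
        gcongr
        rw [ENNReal.le_div_iff_mul_le (Or.inl ha) (Or.inl ha'), mul_comm]
        exact hr b
    _ = 64 / a * ∫⁻ y in ⋃ b ∈ u, ball ((b : {x | a < hlMaximal f x}) : R3) (r b), f y := by
        rw [ENNReal.tsum_mul_left, lintegral_biUnion hcount (fun _ _ => measurableSet_ball) hdisj]
    _ ≤ _ := by
        gcongr
        exact Measure.restrict_le_self

/-- The part of `f` below `a / 2` contributes at most `a / 2` to every average, so only the
truncation `g` matters, at level `a / 2`; hence `128 = 2 * 64`. This refinement makes the later
integral over levels converge. -/
lemma volume_lt_hlMaximal_le_setLIntegral {f : R3 → ℝ≥0∞} (hf : Measurable f) {a : ℝ≥0∞}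
    (ha : a ≠ 0) (ha' : a ≠ ⊤) :
    volume {x | a < hlMaximal f x} ≤ 128 / a * ∫⁻ x in {x | a / 2 < f x}, f x := by
  have hm : MeasurableSet {x | a / 2 < f x} := measurableSet_lt measurable_const hf
  have h2 : a / 2 ≠ ⊤ := ENNReal.div_ne_top ha' (by norm_num)
  set g := indicator {x | a / 2 < f x} f with hg
  have hle : ∀ x, hlMaximal f x ≤ a / 2 + hlMaximal g x := by
    intro x
    refine iSup₂_le fun r hr => ?_
    rw [ENNReal.div_le_iff (measure_ball_pos volume x hr).ne' measure_ball_lt_top.ne, add_mul]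
    calc ∫⁻ y in ball x r, f y ≤ ∫⁻ y in ball x r, (a / 2 + g y) := by
          refine lintegral_mono fun y => ?_
          by_cases hy : a / 2 < f y
          · simp [hg, hy]
          · exact (not_lt.1 hy).trans le_self_add
      _ = a / 2 * volume (ball x r) + ∫⁻ y in ball x r, g y := by
          rw [lintegral_add_left measurable_const, setLIntegral_const]
      _ ≤ _ := by gcongr; exact setLIntegral_ball_le_hlMaximal g x hr
  calc volume {x | a < hlMaximal f x} ≤ volume {x | a / 2 < hlMaximal g x} := by
        refine measure_mono fun x hx => ?_
        have h := lt_of_lt_of_le hx (hle x)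
        by_contra hcon
        have hcon' : hlMaximal g x ≤ a / 2 := not_lt.1 hcon
        have : a / 2 + hlMaximal g x ≤ a := by
          calc a / 2 + hlMaximal g x ≤ a / 2 + a / 2 := by gcongr
            _ = a := ENNReal.add_halves a
        exact absurd h (not_lt.2 this)
    _ ≤ 64 / (a / 2) * ∫⁻ x, g x :=
        volume_lt_hlMaximal_le g (ENNReal.div_ne_zero.2 ⟨ha, by norm_num⟩) h2
    _ = _ := by
        rw [hg, lintegral_indicator hm]
        congr 1
        rw [div_eq_mul_inv, ENNReal.inv_div (by simp) (by simp), ← mul_div_assoc]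
        norm_num

/-- The inner integral after exchanging levels and space: `∫_0^{2c} t^{-1/2} dt = 2 (2c)^{1/2} ≤ 4
c^{1/2}`. -/
lemma lintegral_rpow_neg_half_le (c : ℝ≥0∞) :
    ∫⁻ t in Ioi (0 : ℝ), indicator {t : ℝ | ENNReal.ofReal t / 2 < c}
      (fun t => ENNReal.ofReal (t ^ (-(1 / 2) : ℝ))) t ≤ 4 * c ^ (1 / 2 : ℝ) := by
  rcases eq_or_ne c ⊤ with rfl | hc
  · simp
  obtain ⟨b, rfl⟩ : ∃ b : ℝ≥0, c = b := ⟨c.toNNReal, (ENNReal.coe_toNNReal hc).symm⟩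
  have hm : MeasurableSet {t : ℝ | ENNReal.ofReal t / 2 < b} :=
    measurableSet_lt (by fun_prop) measurable_const
  rw [lintegral_indicator hm, Measure.restrict_restrict hm]
  have hsub : {t : ℝ | ENNReal.ofReal t / 2 < b} ∩ Ioi 0 ⊆ Ioc 0 (2 * (b : ℝ)) := by
    rintro t ⟨ht, ht0⟩
    refine ⟨ht0, ?_⟩
    have ht1 : ENNReal.ofReal t < b * 2 := by
      rwa [mem_ofPred_eq, ENNReal.div_lt_iff (by simp) (by simp)] at ht
    have : (b : ℝ≥0∞) * 2 = ENNReal.ofReal (2 * b) := by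
      rw [ENNReal.ofReal_mul (by norm_num), mul_comm]; simp
    rw [this] at ht1
    exact ((ENNReal.ofReal_lt_ofReal_iff_of_nonneg (le_of_lt ht0)).1 ht1).le
  refine (lintegral_mono_set hsub).trans ?_
  have hint : IntegrableOn (fun t : ℝ => t ^ (-(1 / 2) : ℝ)) (Ioc 0 (2 * (b : ℝ))) := by
    have := intervalIntegral.intervalIntegrable_rpow' (a := 0) (b := 2 * (b : ℝ))
      (r := (-(1 / 2) : ℝ)) (by norm_num)
    rwa [intervalIntegrable_iff_integrableOn_Ioc_of_le (by positivity)] at this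
  rw [← ofReal_integral_eq_lintegral_ofReal hint
    ((ae_restrict_iff' measurableSet_Ioc).2 (ae_of_all _ fun t ht => Real.rpow_nonneg ht.1.le _)),
    ← intervalIntegral.integral_of_le (by positivity), integral_rpow (Or.inl (by norm_num))]
  have e1 : ((-(1 / 2) : ℝ) + 1) = 1 / 2 := by norm_num
  rw [e1, Real.zero_rpow (by norm_num), sub_zero, Real.mul_rpow (by norm_num) b.coe_nonneg]
  have e2 : (4 : ℝ≥0∞) * (b : ℝ≥0∞) ^ (1 / 2 : ℝ) = ENNReal.ofReal (4 * (b : ℝ) ^ (1 / 2 : ℝ)) := by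
    rw [ENNReal.ofReal_mul (by norm_num),
      ← ENNReal.ofReal_rpow_of_nonneg b.coe_nonneg (by norm_num)]
    simp
  rw [e2]
  refine ENNReal.ofReal_le_ofReal ?_
  have h2 : (2 : ℝ) ^ (1 / 2 : ℝ) ≤ 2 := by
    calc (2 : ℝ) ^ (1 / 2 : ℝ) ≤ 2 ^ (1 : ℝ) :=
          Real.rpow_le_rpow_of_exponent_le (by norm_num) (by norm_num)
      _ = 2 := Real.rpow_one 2
  have hb : 0 ≤ (b : ℝ) ^ (1 / 2 : ℝ) := Real.rpow_nonneg b.coe_nonneg _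
  rw [div_le_iff₀ (by norm_num)]
  nlinarith

/-- The `L^{3/2}` maximal inequality, for functions dominated by the maximal function. -/
theorem lintegral_rpow_le_of_le_hlMaximal {f : R3 → ℝ≥0∞} (hf : Measurable f) {F : R3 → ℝ}
    (hF : AEMeasurable F) (hF0 : ∀ x, 0 ≤ F x) (hle : ∀ x, ENNReal.ofReal (F x) ≤ hlMaximal f x) :
    ∫⁻ x, ENNReal.ofReal (F x ^ (3 / 2 : ℝ)) ≤ 768 * ∫⁻ x, f x ^ (3 / 2 : ℝ) := by
  -- The layer-cake formula is applied to the measurable `F`, so the maximal function enters only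
  -- through the outer measure of its superlevel sets. The constant is `768 = (3/2) * 128 * 4`.
  rw [lintegral_rpow_eq_lintegral_meas_lt_mul volume (ae_of_all _ hF0) hF (by norm_num)]
  have step : ∀ t ∈ Ioi (0 : ℝ), volume {x | t < F x} * ENNReal.ofReal (t ^ ((3 / 2 : ℝ) - 1)) ≤
      ∫⁻ x, 128 * f x * indicator {t : ℝ | ENNReal.ofReal t / 2 < f x}
        (fun t => ENNReal.ofReal (t ^ (-(1 / 2) : ℝ))) t := by
    intro t ht
    have ht' : ENNReal.ofReal t ≠ 0 := by simpa using ht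
    have hm : MeasurableSet {x | ENNReal.ofReal t / 2 < f x} := measurableSet_lt measurable_const hf
    have h1 : volume {x | t < F x} ≤
        128 / ENNReal.ofReal t * ∫⁻ x in {x | ENNReal.ofReal t / 2 < f x}, f x := by
      refine (measure_mono fun x hx => ?_).trans
        (volume_lt_hlMaximal_le_setLIntegral hf ht' ENNReal.ofReal_ne_top)
      exact lt_of_lt_of_le ((ENNReal.ofReal_lt_ofReal_iff_of_nonneg (le_of_lt ht)).2 hx) (hle x)
    have h2 : ENNReal.ofReal (t ^ ((3 / 2 : ℝ) - 1)) / ENNReal.ofReal t =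
        ENNReal.ofReal (t ^ (-(1 / 2) : ℝ)) := by
      rw [← ENNReal.ofReal_div_of_pos ht]
      congr 1
      rw [← Real.rpow_sub_one (ne_of_gt ht)]
      norm_num
    calc _ ≤ 128 / ENNReal.ofReal t * (∫⁻ x in {x | ENNReal.ofReal t / 2 < f x}, f x) *
          ENNReal.ofReal (t ^ ((3 / 2 : ℝ) - 1)) := by gcongr
      _ = 128 * ENNReal.ofReal (t ^ (-(1 / 2) : ℝ)) *
          ∫⁻ x in {x | ENNReal.ofReal t / 2 < f x}, f x := by
          rw [← h2]; simp only [div_eq_mul_inv]; ring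
      _ = _ := by
          rw [← lintegral_indicator hm, ← lintegral_const_mul _ (hf.indicator hm)]
          refine lintegral_congr fun x => ?_
          by_cases hx : ENNReal.ofReal t / 2 < f x
          · simp only [indicator, mem_ofPred_eq, hx, if_true]; ring
          · simp [indicator, hx]
  have hmeas : Measurable (Function.uncurry fun (t : ℝ) (x : R3) =>
      128 * f x * indicator {t : ℝ | ENNReal.ofReal t / 2 < f x}
        (fun t => ENNReal.ofReal (t ^ (-(1 / 2) : ℝ))) t) := by
    have hS : MeasurableSet {p : ℝ × R3 | ENNReal.ofReal p.1 / 2 < f p.2} :=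
      measurableSet_lt (by fun_prop) (by fun_prop)
    have : Measurable (indicator {p : ℝ × R3 | ENNReal.ofReal p.1 / 2 < f p.2}
        (fun p => ENNReal.ofReal (p.1 ^ (-(1 / 2) : ℝ)))) :=
      Measurable.indicator (by fun_prop) hS
    exact (measurable_const.mul (hf.comp measurable_snd)).mul this
  calc _ ≤ ENNReal.ofReal (3 / 2) * ∫⁻ t in Ioi (0 : ℝ), ∫⁻ x, 128 * f x *
        indicator {t : ℝ | ENNReal.ofReal t / 2 < f x}
        (fun t => ENNReal.ofReal (t ^ (-(1 / 2) : ℝ))) t := by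
        gcongr 1
        exact setLIntegral_mono' measurableSet_Ioi step
    _ = ENNReal.ofReal (3 / 2) * ∫⁻ x, 128 * f x * ∫⁻ t in Ioi (0 : ℝ),
        indicator {t : ℝ | ENNReal.ofReal t / 2 < f x}
        (fun t => ENNReal.ofReal (t ^ (-(1 / 2) : ℝ))) t := by
        rw [lintegral_lintegral_swap hmeas.aemeasurable]
        congr 1
        refine lintegral_congr fun x => ?_
        rw [lintegral_const_mul]
        exact Measurable.indicator (by fun_prop) (measurableSet_lt (by fun_prop) measurable_const)
    _ ≤ ENNReal.ofReal (3 / 2) * ∫⁻ x, 512 * f x ^ (3 / 2 : ℝ) := by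
        gcongr 1
        refine lintegral_mono fun x => ?_
        calc _ ≤ 128 * f x * (4 * f x ^ (1 / 2 : ℝ)) := by
              gcongr 1; exact lintegral_rpow_neg_half_le _
          _ = 512 * (f x ^ (1 : ℝ) * f x ^ (1 / 2 : ℝ)) := by rw [ENNReal.rpow_one]; ring
          _ = _ := by
              rw [← ENNReal.rpow_add_of_nonneg _ _ (by norm_num) (by norm_num)]; norm_num
    _ = _ := by
        rw [lintegral_const_mul _ (by fun_prop), ← mul_assoc]
        congr 1
        rw [show (512 : ℝ≥0∞) = ENNReal.ofReal 512 by simp, ← ENNReal.ofReal_mul (by norm_num)]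
        norm_num

/-! ### The heat kernel, its derivatives and Gaussian bounds -/

/-- The heat kernel on `ℝ³`. -/
noncomputable def heatKernel (t : ℝ) (z : R3) : ℝ :=
  (4 * Real.pi * t) ^ (-(3 / 2) : ℝ) * Real.exp (-‖z‖ ^ 2 / (4 * t))

/-- The first partial derivatives of the heat kernel. -/
noncomputable def heatKernelD (j : Fin 3) (t : ℝ) (z : R3) : ℝ :=
  -(z j / (2 * t)) * heatKernel t z

/-- The second partial derivatives of the heat kernel. -/
noncomputable def heatKernelDD (i j : Fin 3) (t : ℝ) (z : R3) : ℝ :=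
  (z i * z j / (4 * t ^ 2) - (if i = j then 1 else 0) / (2 * t)) * heatKernel t z

lemma integrable_exp_neg_mul_sq_norm {c : ℝ} (hc : 0 < c) :
    Integrable (fun z : R3 => Real.exp (-c * ‖z‖ ^ 2)) := by
  have h := (GaussianFourier.integrable_cexp_neg_mul_sq_norm_add (V := R3) (b := (c : ℂ))
    (by simpa using hc) 0 0).re
  refine h.congr (ae_of_all _ fun z => ?_)
  simp only [zero_mul, add_zero]
  have : (-(c : ℂ) * (‖z‖ : ℂ) ^ 2) = ((-c * ‖z‖ ^ 2 : ℝ) : ℂ) := by push_cast; ring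
  rw [this]
  exact Complex.exp_ofReal_re _

lemma memLp_exp_neg_mul_sq_norm {c : ℝ} (hc : 0 < c) {p : ℝ≥0∞} (hp : 1 ≤ p) :
    MemLp (fun z : R3 => Real.exp (-c * ‖z‖ ^ 2)) p := by
  have hm : AEStronglyMeasurable (fun z : R3 => Real.exp (-c * ‖z‖ ^ 2)) volume :=
    (by fun_prop : Continuous fun z : R3 => Real.exp (-c * ‖z‖ ^ 2)).aestronglyMeasurable
  rcases eq_or_ne p ⊤ with rfl | hpt
  · refine memLp_top_of_bound hm 1 (ae_of_all _ fun z => ?_)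
    rw [Real.norm_eq_abs, Real.abs_exp, Real.exp_le_one_iff]
    nlinarith [sq_nonneg ‖z‖]
  · have hp0 : p ≠ 0 := (zero_lt_one.trans_le hp).ne'
    rw [← integrable_norm_rpow_iff hm hp0 hpt]
    have hpos : 0 < p.toReal := ENNReal.toReal_pos hp0 hpt
    refine (integrable_exp_neg_mul_sq_norm (mul_pos hpos hc)).congr (ae_of_all _ fun z => ?_)
    simp only [Real.norm_eq_abs, Real.abs_exp]
    rw [← Real.exp_mul]
    ring_nf

lemma heatKernel_pos {t : ℝ} (ht : 0 < t) (z : R3) : 0 < heatKernel t z := by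
  unfold heatKernel; positivity

lemma heatKernel_neg (t : ℝ) (z : R3) : heatKernel t (-z) = heatKernel t z := by
  simp [heatKernel]

lemma heatKernel_eq (t : ℝ) (z : R3) : heatKernel t z =
    (4 * Real.pi * t) ^ (-(3 / 2) : ℝ) * Real.exp (-(1 / (4 * t)) * ‖z‖ ^ 2) := by
  unfold heatKernel; congr 2; ring

lemma integrable_heatKernel {t : ℝ} (ht : 0 < t) : Integrable (heatKernel t) := by
  have := (integrable_exp_neg_mul_sq_norm (c := 1 / (4 * t)) (by positivity)).const_mul
    ((4 * Real.pi * t) ^ (-(3 / 2) : ℝ))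
  exact this.congr (ae_of_all _ fun z => (heatKernel_eq t z).symm)

lemma integral_heatKernel {t : ℝ} (ht : 0 < t) : ∫ z, heatKernel t z = 1 := by
  simp_rw [heatKernel_eq]
  rw [integral_const_mul, GaussianFourier.integral_rexp_neg_mul_sq_norm (by positivity)]
  have : Real.pi / (1 / (4 * t)) = 4 * Real.pi * t := by field_simp
  rw [this, finrank_euclideanSpace_fin, ← Real.rpow_add (by positivity)]
  norm_num

lemma lintegral_heatKernel {t : ℝ} (ht : 0 < t) : ∫⁻ z, ENNReal.ofReal (heatKernel t z) = 1 := by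
  rw [← ofReal_integral_eq_lintegral_ofReal (integrable_heatKernel ht)
    (ae_of_all _ fun z => (heatKernel_pos ht z).le), integral_heatKernel ht, ENNReal.ofReal_one]

lemma measurable_heatKernel : Measurable (Function.uncurry heatKernel) := by
  unfold heatKernel Function.uncurry
  fun_prop

lemma measurable_heatKernelD (j : Fin 3) : Measurable (Function.uncurry (heatKernelD j)) := by
  have := measurable_heatKernel
  unfold Function.uncurry at *
  unfold heatKernelD
  fun_prop

lemma measurable_heatKernelDD (i j : Fin 3) :
    Measurable (Function.uncurry (heatKernelDD i j)) := by
  have := measurable_heatKernel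
  unfold Function.uncurry at *
  unfold heatKernelDD
  fun_prop

lemma heatKernel_le_sup {t : ℝ} (ht : 0 < t) (z : R3) :
    heatKernel t z ≤ (4 * Real.pi * t) ^ (-(3 / 2) : ℝ) := by
  unfold heatKernel
  refine mul_le_of_le_one_right (by positivity) (Real.exp_le_one_iff.2 ?_)
  rw [neg_div]
  have : 0 ≤ ‖z‖ ^ 2 / (4 * t) := by positivity
  linarith

lemma heatKernel_le_gaussian {ε t T : ℝ} (hε : 0 < ε) (h1 : ε ≤ t) (h2 : t ≤ T) (z : R3) :
    heatKernel t z ≤ (4 * Real.pi * ε) ^ (-(3 / 2) : ℝ) * Real.exp (-(1 / (4 * T)) * ‖z‖ ^ 2) := by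
  have ht : 0 < t := hε.trans_le h1
  rw [heatKernel_eq]
  refine mul_le_mul ?_ ?_ (Real.exp_pos _).le (by positivity)
  · exact Real.rpow_le_rpow_of_nonpos (by positivity) (by gcongr) (by norm_num)
  · refine Real.exp_le_exp.2 ?_
    gcongr

lemma abs_coord_le_norm (z : R3) (i : Fin 3) : |z i| ≤ ‖z‖ := by
  simpa using PiLp.norm_apply_le z i

/-- Half of the Gaussian exponent is split off to absorb the polynomial factors of the derivatives;
the other half is the kernel at time `2 * t`, and `2^{3/2}` is the ratio of the normalizations. -/
lemma heatKernel_eq_double {t : ℝ} (ht : 0 < t) (z : R3) : heatKernel t z =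
    2 ^ (3 / 2 : ℝ) * Real.exp (-(‖z‖ ^ 2 / (8 * t))) * heatKernel (2 * t) z := by
  unfold heatKernel
  have h1 : (4 * Real.pi * (2 * t)) ^ (-(3 / 2) : ℝ) =
      2 ^ (-(3 / 2) : ℝ) * (4 * Real.pi * t) ^ (-(3 / 2) : ℝ) := by
    rw [← Real.mul_rpow (by norm_num) (by positivity)]; congr 1; ring
  have h2 : (2 : ℝ) ^ (3 / 2 : ℝ) * 2 ^ (-(3 / 2) : ℝ) = 1 := by
    rw [← Real.rpow_add (by norm_num)]; norm_num
  have h3 : Real.exp (-‖z‖ ^ 2 / (4 * t)) =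
      Real.exp (-(‖z‖ ^ 2 / (8 * t))) * Real.exp (-‖z‖ ^ 2 / (4 * (2 * t))) := by
    rw [← Real.exp_add]; congr 1; field_simp; ring
  rw [h1, h3]
  linear_combination (-(4 * Real.pi * t) ^ (-(3 / 2) : ℝ) * (Real.exp (-(‖z‖ ^ 2 / (8 * t))) *
    Real.exp (-‖z‖ ^ 2 / (4 * (2 * t))))) * h2

lemma two_rpow_three_halves_le : (2 : ℝ) ^ (3 / 2 : ℝ) ≤ 3 := by
  have h : ((2 : ℝ) ^ (3 / 2 : ℝ)) ^ 2 = 8 := by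
    rw [← Real.rpow_natCast, ← Real.rpow_mul (by norm_num)]; norm_num
  nlinarith [Real.rpow_pos_of_pos (show (0 : ℝ) < 2 by norm_num) (3 / 2)]

lemma abs_heatKernelD_le (j : Fin 3) {t : ℝ} (ht : 0 < t) (z : R3) :
    |heatKernelD j t z| ≤ 3 * t ^ (-(1 / 2) : ℝ) * heatKernel (2 * t) z := by
  have hk := heatKernel_pos (show 0 < 2 * t by positivity) z
  have hz := abs_coord_le_norm z j
  set s := Real.sqrt t with hs
  have hs0 : 0 < s := Real.sqrt_pos.2 ht
  have hst : s ^ 2 = t := Real.sq_sqrt ht.le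
  have hr : t ^ (-(1 / 2) : ℝ) = s⁻¹ := by
    rw [Real.rpow_neg ht.le, ← Real.sqrt_eq_rpow]
  have he : ‖z‖ / (2 * t) * Real.exp (-(‖z‖ ^ 2 / (8 * t))) ≤ s⁻¹ := by
    rw [Real.exp_neg, ← div_eq_mul_inv, div_le_iff₀ (Real.exp_pos _)]
    have h1 := Real.add_one_le_exp (‖z‖ ^ 2 / (8 * t))
    have h2 : ‖z‖ / (2 * t) ≤ s⁻¹ * (‖z‖ ^ 2 / (8 * t) + 1) := by
      rw [← hst]
      -- With `s = √t`, completing the square shows that `e^x ≥ 1 + x` already dominates the linear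
      -- factor.
      have h3 : 0 ≤ (‖z‖ - 2 * s) ^ 2 + 4 * s ^ 2 := by positivity
      have h4 : s⁻¹ * (‖z‖ ^ 2 / (8 * s ^ 2) + 1) - ‖z‖ / (2 * s ^ 2) =
          ((‖z‖ - 2 * s) ^ 2 + 4 * s ^ 2) / (8 * s ^ 3) := by
        field_simp; ring
      have h5 : 0 ≤ ((‖z‖ - 2 * s) ^ 2 + 4 * s ^ 2) / (8 * s ^ 3) := by positivity
      linarith
    exact h2.trans (by gcongr)
  rw [heatKernelD, abs_mul, abs_neg, abs_div, abs_of_pos (heatKernel_pos ht z),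
    abs_of_pos (show 0 < 2 * t by positivity), heatKernel_eq_double ht, hr]
  calc |z j| / (2 * t) * (2 ^ (3 / 2 : ℝ) * Real.exp (-(‖z‖ ^ 2 / (8 * t))) * heatKernel (2 * t) z)
      ≤ ‖z‖ / (2 * t) *
        (2 ^ (3 / 2 : ℝ) * Real.exp (-(‖z‖ ^ 2 / (8 * t))) * heatKernel (2 * t) z) := by gcongr
    _ = 2 ^ (3 / 2 : ℝ) * (‖z‖ / (2 * t) * Real.exp (-(‖z‖ ^ 2 / (8 * t)))) *
        heatKernel (2 * t) z := by ring
    _ ≤ 3 * s⁻¹ * heatKernel (2 * t) z := by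
        gcongr
        exact two_rpow_three_halves_le

lemma abs_heatKernelDD_le (i j : Fin 3) {t : ℝ} (ht : 0 < t) (z : R3) :
    |heatKernelDD i j t z| ≤ 8 / t * heatKernel (2 * t) z := by
  have hk := heatKernel_pos (show 0 < 2 * t by positivity) z
  have hzi := abs_coord_le_norm z i
  have hzj := abs_coord_le_norm z j
  have h1 : |z i * z j / (4 * t ^ 2) - (if i = j then 1 else 0) / (2 * t)| ≤
      ‖z‖ ^ 2 / (4 * t ^ 2) + 1 / (2 * t) := by
    refine (abs_sub _ _).trans ?_
    rw [abs_div, abs_div, abs_mul, abs_of_pos (show 0 < 4 * t ^ 2 by positivity),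
      abs_of_pos (show 0 < 2 * t by positivity)]
    gcongr
    · rw [sq]; gcongr
    · split_ifs <;> simp
  have he : (‖z‖ ^ 2 / (4 * t ^ 2) + 1 / (2 * t)) * Real.exp (-(‖z‖ ^ 2 / (8 * t))) ≤ 2 / t := by
    rw [Real.exp_neg, ← div_eq_mul_inv, div_le_iff₀ (Real.exp_pos _)]
    have h1 := Real.add_one_le_exp (‖z‖ ^ 2 / (8 * t))
    have h2 : ‖z‖ ^ 2 / (4 * t ^ 2) + 1 / (2 * t) ≤ 2 / t * (‖z‖ ^ 2 / (8 * t) + 1) := by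
      have h4 : 2 / t * (‖z‖ ^ 2 / (8 * t) + 1) - (‖z‖ ^ 2 / (4 * t ^ 2) + 1 / (2 * t)) =
          3 / (2 * t) := by
        field_simp; ring
      have h5 : 0 ≤ 3 / (2 * t) := by positivity
      linarith
    exact h2.trans (by gcongr)
  rw [heatKernelDD, abs_mul, abs_of_pos (heatKernel_pos ht z), heatKernel_eq_double ht]
  calc _ ≤ (‖z‖ ^ 2 / (4 * t ^ 2) + 1 / (2 * t)) *
        (2 ^ (3 / 2 : ℝ) * Real.exp (-(‖z‖ ^ 2 / (8 * t))) * heatKernel (2 * t) z) := by gcongr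
    _ = 2 ^ (3 / 2 : ℝ) * ((‖z‖ ^ 2 / (4 * t ^ 2) + 1 / (2 * t)) *
        Real.exp (-(‖z‖ ^ 2 / (8 * t)))) * heatKernel (2 * t) z := by ring
    _ ≤ 3 * (2 / t) * heatKernel (2 * t) z := by
        gcongr
        exact two_rpow_three_halves_le
    _ ≤ _ := by
        gcongr ?_ * _
        rw [← mul_div_assoc]; gcongr; norm_num

/-- One Gaussian dominates the kernels for all times in `[ε, T]`: the smallest time controls the
prefactor, the largest the exponent. -/
lemma exists_abs_heatKernelD_le {ε T : ℝ} (hε : 0 < ε) (j : Fin 3) : ∃ C, ∀ t ∈ Icc ε T,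
    ∀ z : R3, |heatKernelD j t z| ≤ C * Real.exp (-(1 / (8 * T)) * ‖z‖ ^ 2) := by
  refine ⟨3 * ε ^ (-(1 / 2) : ℝ) * (4 * Real.pi * (2 * ε)) ^ (-(3 / 2) : ℝ), fun t ht z => ?_⟩
  have ht0 : 0 < t := hε.trans_le ht.1
  refine (abs_heatKernelD_le j ht0 z).trans ?_
  rw [mul_assoc (3 * ε ^ (-(1 / 2) : ℝ))]
  have h1 := heatKernel_le_gaussian (ε := 2 * ε) (t := 2 * t) (T := 2 * T) (by positivity)
    (by linarith [ht.1]) (by linarith [ht.2]) z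
  have e : 4 * (2 * T) = 8 * T := by ring
  rw [e] at h1
  refine mul_le_mul ?_ h1 (heatKernel_pos (by positivity) z).le (by positivity)
  exact mul_le_mul_of_nonneg_left (Real.rpow_le_rpow_of_nonpos hε ht.1 (by norm_num)) (by norm_num)

lemma exists_abs_heatKernelDD_le {ε T : ℝ} (hε : 0 < ε) (i j : Fin 3) : ∃ C, ∀ t ∈ Icc ε T,
    ∀ z : R3, |heatKernelDD i j t z| ≤ C * Real.exp (-(1 / (8 * T)) * ‖z‖ ^ 2) := by
  refine ⟨8 / ε * (4 * Real.pi * (2 * ε)) ^ (-(3 / 2) : ℝ), fun t ht z => ?_⟩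
  have ht0 : 0 < t := hε.trans_le ht.1
  refine (abs_heatKernelDD_le i j ht0 z).trans ?_
  rw [mul_assoc (8 / ε)]
  have h1 := heatKernel_le_gaussian (ε := 2 * ε) (t := 2 * t) (T := 2 * T) (by positivity)
    (by linarith [ht.1]) (by linarith [ht.2]) z
  have e : 4 * (2 * T) = 8 * T := by ring
  rw [e] at h1
  refine mul_le_mul ?_ h1 (heatKernel_pos (by positivity) z).le (by positivity)
  have := ht.1
  gcongr

lemma contDiff_heatKernel (t : ℝ) : ContDiff ℝ ∞ (heatKernel t) := by
  unfold heatKernel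
  exact contDiff_const.mul (((contDiff_norm_sq ℝ).neg.div_const _).exp)

lemma contDiff_coord (j : Fin 3) : ContDiff ℝ ∞ (fun z : R3 => z j) :=
  (EuclideanSpace.proj j : R3 →L[ℝ] ℝ).contDiff

lemma contDiff_heatKernelD (j : Fin 3) (t : ℝ) : ContDiff ℝ ∞ (heatKernelD j t) := by
  unfold heatKernelD
  exact ((contDiff_coord j).div_const _).neg.mul (contDiff_heatKernel t)

lemma continuous_heatKernelDD (i j : Fin 3) (t : ℝ) : Continuous (heatKernelDD i j t) := by
  unfold heatKernelDD
  have := (contDiff_heatKernel t).continuous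
  fun_prop

lemma partialDeriv_heatKernel (i : Fin 3) {t : ℝ} (ht : 0 < t) (z : R3) :
    partialDeriv i (heatKernel t) z = heatKernelD i t z := by
  have h1 : HasFDerivAt (fun z : R3 => ‖z‖ ^ 2) (2 • innerSL ℝ z) z :=
    (hasStrictFDerivAt_norm_sq z).hasFDerivAt
  have h2 := ((h1.fun_neg.mul_const ((4 * t)⁻¹)).exp).const_mul ((4 * Real.pi * t) ^ (-(3 / 2) : ℝ))
  have h3 : HasFDerivAt (heatKernel t) _ z := h2
  unfold partialDeriv
  rw [h3.fderiv]
  simp [heatKernelD, heatKernel, EuclideanSpace.inner_single_right]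
  field_simp
  norm_num

lemma partialDeriv_heatKernelD (i j : Fin 3) {t : ℝ} (ht : 0 < t) (z : R3) :
    partialDeriv i (heatKernelD j t) z = heatKernelDD i j t z := by
  have h1 : HasFDerivAt (fun z : R3 => z j) (EuclideanSpace.proj j : R3 →L[ℝ] ℝ) z :=
    (EuclideanSpace.proj j : R3 →L[ℝ] ℝ).hasFDerivAt
  have h2 : HasFDerivAt (heatKernel t) (fderiv ℝ (heatKernel t) z) z :=
    ((contDiff_heatKernel t).differentiable (by simp) z).hasFDerivAt
  have h3 : HasFDerivAt (heatKernelD j t) _ z := ((h1.mul_const ((2 * t)⁻¹)).fun_neg).mul h2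
  have h4 := partialDeriv_heatKernel i ht z
  unfold partialDeriv at h4 ⊢
  rw [h3.fderiv]
  simp only [add_apply, smul_apply, h4]
  by_cases hij : j = i
  · simp [heatKernelD, heatKernelDD, hij]
    field_simp
    ring
  · simp [heatKernelD, heatKernelDD, hij, Ne.symm hij]
    field_simp
    ring

/-- The heat equation, with the Laplacian written as the trace of the second-derivative kernels. -/
lemma hasDerivAt_heatKernel {t : ℝ} (ht : 0 < t) (z : R3) :
    HasDerivAt (fun s => heatKernel s z) (∑ j, heatKernelDD j j t z) t := by
  have h1 : HasDerivAt (fun s : ℝ => (4 * Real.pi * s) ^ (-(3 / 2) : ℝ))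
      (4 * Real.pi * 1 * (-(3 / 2)) * (4 * Real.pi * t) ^ ((-(3 / 2) : ℝ) - 1)) t :=
    ((hasDerivAt_id t).const_mul (4 * Real.pi)).rpow_const (Or.inl (by simp; positivity))
  have h2 : HasDerivAt (fun s : ℝ => -‖z‖ ^ 2 / (4 * s)) (‖z‖ ^ 2 / (4 * t ^ 2)) t := by
    have := ((hasDerivAt_id t).const_mul 4).fun_inv (by simp; positivity)
    have := this.const_mul (-‖z‖ ^ 2)
    refine this.congr_deriv ?_
    simp only [id]
    field_simp
  have h3 := h1.mul h2.exp
  refine h3.congr_deriv ?_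
  have e1 : (4 * Real.pi * t) ^ ((-(3 / 2) : ℝ) - 1) =
      (4 * Real.pi * t) ^ (-(3 / 2) : ℝ) / (4 * Real.pi * t) :=
    Real.rpow_sub_one (by positivity) _
  have e2 : ‖z‖ ^ 2 = z 0 ^ 2 + z 1 ^ 2 + z 2 ^ 2 := by
    rw [EuclideanSpace.norm_sq_eq, Fin.sum_univ_three]; simp
  rw [e1, Fin.sum_univ_three]
  simp only [heatKernelDD, heatKernel, if_true]
  rw [show ‖z‖ ^ 2 / (4 * t ^ 2) = (z 0 ^ 2 + z 1 ^ 2 + z 2 ^ 2) / (4 * t ^ 2) by rw [e2]]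
  field_simp
  ring

/-- By the parallelogram law, a product of two Gaussians of equal variance splits into a function of
the separation `z` and a function of the displacement `v` from the midpoint. -/
lemma heatKernel_mul_heatKernel {s : ℝ} (hs : 0 < s) (z v : R3) :
    heatKernel s ((1 / 2 : ℝ) • z + v) * heatKernel s ((1 / 2 : ℝ) • z - v) =
      heatKernel (2 * s) z * heatKernel (s / 2) v := by
  have h1 : ‖(1 / 2 : ℝ) • z + v‖ ^ 2 + ‖(1 / 2 : ℝ) • z - v‖ ^ 2 = ‖z‖ ^ 2 / 2 + 2 * ‖v‖ ^ 2 := by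
    have h := parallelogram_law_with_norm ℝ ((1 / 2 : ℝ) • z) v
    have h2 : ‖(1 / 2 : ℝ) • z‖ = ‖z‖ / 2 := by rw [norm_smul]; norm_num; ring
    rw [h2] at h
    nlinarith
  unfold heatKernel
  rw [mul_mul_mul_comm, mul_mul_mul_comm ((4 * Real.pi * (2 * s)) ^ (-(3 / 2) : ℝ)),
    ← Real.mul_rpow (by positivity) (by positivity),
    ← Real.mul_rpow (by positivity) (by positivity), ← Real.exp_add, ← Real.exp_add]
  congr 2
  · ring
  · rw [← add_div, ← neg_add, h1]
    field_simp
    ring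

lemma integrable_heatKernelD (j : Fin 3) {t : ℝ} (ht : 0 < t) : Integrable (heatKernelD j t) := by
  refine ((integrable_heatKernel (show 0 < 2 * t by positivity)).const_mul
    (3 * t ^ (-(1 / 2) : ℝ))).mono' (contDiff_heatKernelD j t).continuous.aestronglyMeasurable ?_
  exact ae_of_all _ fun z => abs_heatKernelD_le j ht z

lemma heatKernelD_neg (j : Fin 3) (t : ℝ) (z : R3) :
    heatKernelD j t (-z) = - heatKernelD j t z := by
  simp only [heatKernelD, heatKernel_neg, PiLp.neg_apply]; ring

lemma integral_heatKernelD (j : Fin 3) (t : ℝ) : ∫ z, heatKernelD j t z = 0 := by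
  have h := integral_neg_eq_self (heatKernelD j t) volume
  simp_rw [heatKernelD_neg] at h
  rw [integral_neg] at h
  linarith

/-- The semigroup property, differentiated once. -/
lemma integral_heatKernelD_mul_heatKernel (j : Fin 3) {s : ℝ} (hs : 0 < s) (z : R3) :
    ∫ w, heatKernelD j s w * heatKernel s (z - w) = heatKernelD j (2 * s) z := by
  -- Centring at the midpoint `z / 2` leaves a term with unit mass in `v` and a term odd in `v`,
  -- which integrates to zero.
  rw [← integral_add_left_eq_self _ ((1 / 2 : ℝ) • z)]
  have h : ∀ v : R3, heatKernelD j s ((1 / 2 : ℝ) • z + v) *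
      heatKernel s (z - ((1 / 2 : ℝ) • z + v)) =
      heatKernelD j (2 * s) z * heatKernel (s / 2) v +
        heatKernel (2 * s) z / 2 * heatKernelD j (s / 2) v := by
    intro v
    have e : z - ((1 / 2 : ℝ) • z + v) = (1 / 2 : ℝ) • z - v := by
      ext i; simp; ring
    rw [e, heatKernelD, mul_assoc, heatKernel_mul_heatKernel hs]
    simp only [heatKernelD, PiLp.add_apply, PiLp.smul_apply, smul_eq_mul]
    field_simp
    ring
  simp_rw [h]
  rw [integral_add ((integrable_heatKernel (by positivity)).const_mul _)
    ((integrable_heatKernelD j (by positivity)).const_mul _), integral_const_mul,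
    integral_const_mul, integral_heatKernel (by positivity), integral_heatKernelD]
  ring

/-! ### Gaussian averages and the maximal function -/

/-- The fundamental theorem of calculus on `(r, ∞)`; it exhibits a Gaussian as a positive
superposition of indicators of balls. -/
lemma ofReal_exp_neg_mul_sq_eq_lintegral {a : ℝ} (ha : 0 < a) {r : ℝ} (hr : 0 ≤ r) :
    ENNReal.ofReal (Real.exp (-a * r ^ 2)) =
      ∫⁻ s in Ioi r, ENNReal.ofReal (2 * a * s * Real.exp (-a * s ^ 2)) := by
  have hd : ∀ s ∈ Ici r, HasDerivAt (fun s : ℝ => -Real.exp (-a * s ^ 2))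
      (2 * a * s * Real.exp (-a * s ^ 2)) s := by
    intro s _
    have := (((hasDerivAt_pow 2 s).const_mul (-a)).exp).fun_neg
    refine this.congr_deriv ?_
    simp
    ring
  have hlim : Filter.Tendsto (fun s : ℝ => -Real.exp (-a * s ^ 2)) Filter.atTop (nhds 0) := by
    rw [← neg_zero]
    refine (Real.tendsto_exp_atBot.comp ?_).neg
    exact (Filter.tendsto_pow_atTop two_ne_zero).const_mul_atTop_of_neg (by linarith)
  have hpos : ∀ s ∈ Ioi r, 0 ≤ 2 * a * s * Real.exp (-a * s ^ 2) := by
    intro s hs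
    have : 0 < s := hr.trans_lt hs
    positivity
  have hint := integrableOn_Ioi_deriv_of_nonneg' hd hpos hlim
  have hval := integral_Ioi_of_hasDerivAt_of_tendsto' hd hint hlim
  rw [← ofReal_integral_eq_lintegral_ofReal hint
    ((ae_restrict_iff' measurableSet_Ioi).2 (ae_of_all _ hpos)), hval]
  simp

/-- Convolution with a Gaussian is dominated by the maximal function. -/
lemma lintegral_gaussian_mul_le_hlMaximal {f : R3 → ℝ≥0∞} (hf : Measurable f) {a : ℝ} (ha : 0 < a)
    (x : R3) : ∫⁻ y, ENNReal.ofReal (Real.exp (-a * ‖x - y‖ ^ 2)) * f y ≤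
      hlMaximal f x * ∫⁻ y : R3, ENNReal.ofReal (Real.exp (-a * ‖y‖ ^ 2)) := by
  set w : ℝ → ℝ≥0∞ := fun s => ENNReal.ofReal (2 * a * s * Real.exp (-a * s ^ 2)) with hw
  have hwm : Measurable w := by fun_prop
  have key : ∀ h : R3 → ℝ≥0∞, Measurable h →
      ∫⁻ y, ENNReal.ofReal (Real.exp (-a * ‖x - y‖ ^ 2)) * h y =
        ∫⁻ s in Ioi (0 : ℝ), w s * ∫⁻ y in ball x s, h y := by
    intro h hh
    have h1 : ∀ y, ENNReal.ofReal (Real.exp (-a * ‖x - y‖ ^ 2)) * h y =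
        ∫⁻ s in Ioi (0 : ℝ), indicator {s : ℝ | ‖x - y‖ < s} (fun s => w s * h y) s := by
      intro y
      rw [ofReal_exp_neg_mul_sq_eq_lintegral ha (norm_nonneg _), ← lintegral_mul_const _ hwm]
      have hm : MeasurableSet {s : ℝ | ‖x - y‖ < s} := measurableSet_Ioi
      rw [lintegral_indicator hm, Measure.restrict_restrict hm]
      congr 2
      ext s
      exact ⟨fun hs => ⟨hs, (norm_nonneg _).trans_lt hs⟩, fun hs => hs.1⟩
    have hS : MeasurableSet {p : R3 × ℝ | ‖x - p.1‖ < p.2} :=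
      measurableSet_lt (by fun_prop) (by fun_prop)
    have hmeas : Measurable (Function.uncurry fun (y : R3) (s : ℝ) =>
        indicator {s : ℝ | ‖x - y‖ < s} (fun s => w s * h y) s) := by
      have : Measurable (indicator {p : R3 × ℝ | ‖x - p.1‖ < p.2} (fun p => w p.2 * h p.1)) :=
        Measurable.indicator (by fun_prop) hS
      exact this
    simp_rw [h1]
    rw [lintegral_lintegral_swap hmeas.aemeasurable]
    refine lintegral_congr fun s => ?_
    rw [← lintegral_const_mul _ hh, ← lintegral_indicator measurableSet_ball]
    refine lintegral_congr fun y => ?_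
    simp only [indicator, mem_ball, dist_eq_norm, norm_sub_rev x y]
    rfl
  -- The same superposition with `f` replaced by `1` gives the mass of the Gaussian, so comparing
  -- the two ball by ball suffices.
  have h1 : ∫⁻ y : R3, ENNReal.ofReal (Real.exp (-a * ‖y‖ ^ 2)) =
      ∫⁻ y, ENNReal.ofReal (Real.exp (-a * ‖x - y‖ ^ 2)) * 1 := by
    simp_rw [mul_one]
    exact (lintegral_sub_left_eq_self (fun y : R3 => ENNReal.ofReal (Real.exp (-a * ‖y‖ ^ 2)))
      x).symm
  have hgm : Measurable fun s : ℝ => w s * ∫⁻ _ in ball x s, (1 : ℝ≥0∞) := by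
    refine hwm.mul ?_
    simp only [setLIntegral_const, one_mul]
    exact (Monotone.measurable fun s t hst => measure_mono (ball_subset_ball hst))
  rw [h1, key f hf, key _ measurable_const, ← lintegral_const_mul _ hgm]
  refine setLIntegral_mono' measurableSet_Ioi fun s hs => ?_
  rw [mul_left_comm]
  gcongr
  simpa using setLIntegral_ball_le_hlMaximal f x hs

lemma lintegral_heatKernel_mul_le_hlMaximal {f : R3 → ℝ≥0∞} (hf : Measurable f) {t : ℝ}
    (ht : 0 < t) (x : R3) :
    ∫⁻ y, ENNReal.ofReal (heatKernel t (x - y)) * f y ≤ hlMaximal f x := by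
  have h1 : ∀ z, ENNReal.ofReal (heatKernel t z) = ENNReal.ofReal
      ((4 * Real.pi * t) ^ (-(3 / 2) : ℝ)) *
        ENNReal.ofReal (Real.exp (-(1 / (4 * t)) * ‖z‖ ^ 2)) := by
    intro z
    rw [heatKernel_eq, ENNReal.ofReal_mul (by positivity)]
  have h2 := lintegral_heatKernel ht
  simp_rw [h1] at h2 ⊢
  rw [lintegral_const_mul _ (by fun_prop)] at h2
  have h3 : ∀ y, ENNReal.ofReal ((4 * Real.pi * t) ^ (-(3 / 2) : ℝ)) *
      ENNReal.ofReal (Real.exp (-(1 / (4 * t)) * ‖x - y‖ ^ 2)) * f y =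
      ENNReal.ofReal ((4 * Real.pi * t) ^ (-(3 / 2) : ℝ)) *
      (ENNReal.ofReal (Real.exp (-(1 / (4 * t)) * ‖x - y‖ ^ 2)) * f y) := fun y => mul_assoc _ _ _
  simp_rw [h3]
  rw [lintegral_const_mul _ (by fun_prop)]
  refine (mul_le_mul_right (lintegral_gaussian_mul_le_hlMaximal hf (by positivity) x) _).trans_eq ?_
  rw [mul_left_comm, h2, mul_one]

/-! ### Convolution in `L³` and the heat flow at small and large times -/

open Filter Topology

/-- Hölder with exponents `3/2` and `3` after writing `k h = k^{2/3} (k^{1/3} h)`; this is Jensen's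
inequality for a weight that need not have mass one. -/
lemma lintegral_mul_rpow_three_le {α : Type*} [MeasurableSpace α] {μ : Measure α}
    {k h : α → ℝ≥0∞} (hk : AEMeasurable k μ) (hh : AEMeasurable h μ) :
    (∫⁻ y, k y * h y ∂μ) ^ (3 : ℝ) ≤ (∫⁻ y, k y ∂μ) ^ (2 : ℝ) * ∫⁻ y, k y * h y ^ (3 : ℝ) ∂μ := by
  have hpq : (3 / 2 : ℝ).HolderConjugate 3 := by
    rw [Real.holderConjugate_iff]; norm_num
  have h1 := ENNReal.lintegral_mul_le_Lp_mul_Lq μ hpq (hk.pow_const (2 / 3 : ℝ))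
    ((hk.pow_const (1 / 3 : ℝ)).mul hh)
  have e1 : ∀ y, k y ^ (2 / 3 : ℝ) * (k y ^ (1 / 3 : ℝ) * h y) = k y * h y := by
    intro y
    rw [← mul_assoc, ← ENNReal.rpow_add_of_nonneg _ _ (by norm_num) (by norm_num)]
    norm_num
  have e2 : ∀ y, (k y ^ (2 / 3 : ℝ)) ^ (3 / 2 : ℝ) = k y := by
    intro y; rw [← ENNReal.rpow_mul]; norm_num
  have e3 : ∀ y, (k y ^ (1 / 3 : ℝ) * h y) ^ (3 : ℝ) = k y * h y ^ (3 : ℝ) := by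
    intro y; rw [ENNReal.mul_rpow_of_nonneg _ _ (by norm_num), ← ENNReal.rpow_mul]; norm_num
  simp only [Pi.mul_apply, e1, e2, e3] at h1
  refine (ENNReal.rpow_le_rpow h1 (by norm_num)).trans_eq ?_
  rw [ENNReal.mul_rpow_of_nonneg _ _ (by norm_num), ← ENNReal.rpow_mul, ← ENNReal.rpow_mul]
  norm_num

/-- Minkowski's integral inequality in `L³`, in the weighted form given by Jensen. -/
lemma lintegral_lintegral_mul_rpow_three_le {k : R3 → ℝ≥0∞} (hk : AEMeasurable k)
    {H : R3 → R3 → ℝ≥0∞} (hH : AEMeasurable (Function.uncurry H) (volume.prod volume)) :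
    ∫⁻ x, (∫⁻ y, k y * H x y) ^ (3 : ℝ) ≤
      (∫⁻ y, k y) ^ (2 : ℝ) * ∫⁻ y, k y * ∫⁻ x, H x y ^ (3 : ℝ) := by
  have hHs : AEMeasurable (Function.uncurry fun y x => H x y) (volume.prod volume) := hH.prod_swap
  have hx : ∀ᵐ x : R3, AEMeasurable (H x) volume := by
    filter_upwards [hH.aestronglyMeasurable.prodMk_left] with x hx using hx.aemeasurable
  have hy : ∀ᵐ y : R3, AEMeasurable (fun x => H x y) volume := by
    filter_upwards [hHs.aestronglyMeasurable.prodMk_left] with x hx using hx.aemeasurable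
  have hprod : AEMeasurable (Function.uncurry fun x y => k y * H x y ^ (3 : ℝ))
      (volume.prod volume) := (hk.comp_snd).mul (hH.pow_const _)
  calc _ ≤ ∫⁻ x, (∫⁻ y, k y) ^ (2 : ℝ) * ∫⁻ y, k y * H x y ^ (3 : ℝ) := by
        refine lintegral_mono_ae ?_
        filter_upwards [hx] with x hx using lintegral_mul_rpow_three_le hk hx
    _ = (∫⁻ y, k y) ^ (2 : ℝ) * ∫⁻ y, ∫⁻ x, k y * H x y ^ (3 : ℝ) := by
        have hm : AEMeasurable (fun x => ∫⁻ y, k y * H x y ^ (3 : ℝ)) volume :=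
          hprod.lintegral_prod_right'
        rw [lintegral_const_mul'' _ hm, lintegral_lintegral_swap hprod]
    _ = _ := by
        congr 1
        refine lintegral_congr_ae ?_
        filter_upwards [hy] with y hy
        rw [lintegral_const_mul'' _ (hy.pow_const _)]

lemma eLpNorm_three_eq {E : Type*} [NormedAddCommGroup E] (f : R3 → E) :
    eLpNorm f 3 volume = (∫⁻ x, ‖f x‖ₑ ^ (3 : ℝ)) ^ (1 / 3 : ℝ) := by
  rw [eLpNorm_eq_lintegral_rpow_enorm_toReal (by norm_num) (by norm_num)]
  simp

lemma eLpNorm_three_rpow {E : Type*} [NormedAddCommGroup E] (f : R3 → E) :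
    eLpNorm f 3 volume ^ (3 : ℝ) = ∫⁻ x, ‖f x‖ₑ ^ (3 : ℝ) := by
  rw [eLpNorm_three_eq, ← ENNReal.rpow_mul]
  norm_num

/-- The convolution `k * f` of real functions on `ℝ³`. -/
noncomputable def kconv (k f : R3 → ℝ) (x : R3) : ℝ := ∫ y, k (x - y) * f y

lemma kconv_eq (k f : R3 → ℝ) (x : R3) : kconv k f x = ∫ y, k y * f (x - y) := by
  unfold kconv
  rw [← integral_sub_left_eq_self _ volume x]
  simp

lemma kconv_comm (k f : R3 → ℝ) : kconv k f = kconv f k := by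
  ext x
  rw [kconv_eq, kconv]
  simp_rw [mul_comm]

lemma aestronglyMeasurable_comp_sub {f : R3 → ℝ} (hf : AEStronglyMeasurable f volume) :
    AEStronglyMeasurable (fun p : R3 × R3 => f (p.1 - p.2)) (volume.prod volume) :=
  hf.comp_quasiMeasurePreserving (quasiMeasurePreserving_sub volume volume)

lemma aestronglyMeasurable_kconv {k f : R3 → ℝ} (hk : AEStronglyMeasurable k volume)
    (hf : AEStronglyMeasurable f volume) : AEStronglyMeasurable (kconv k f) volume := by
  have : AEStronglyMeasurable (fun p : R3 × R3 => k (p.1 - p.2) * f p.2) (volume.prod volume) :=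
    (aestronglyMeasurable_comp_sub hk).mul hf.comp_snd
  exact AEStronglyMeasurable.integral_prod_right' this

/-- Young's inequality `‖k * f‖₃ ≤ ‖k‖₁ ‖f‖₃`. -/
lemma eLpNorm_kconv_le {k f : R3 → ℝ} (hk : AEStronglyMeasurable k volume)
    (hf : AEStronglyMeasurable f volume) :
    eLpNorm (kconv k f) 3 volume ≤ (∫⁻ y, ‖k y‖ₑ) * eLpNorm f 3 volume := by
  rw [← ENNReal.rpow_le_rpow_iff (show (0 : ℝ) < 3 by norm_num),
    ENNReal.mul_rpow_of_nonneg _ _ (by norm_num), eLpNorm_three_rpow, eLpNorm_three_rpow]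
  calc _ ≤ ∫⁻ x, (∫⁻ y, ‖k y‖ₑ * ‖f (x - y)‖ₑ) ^ (3 : ℝ) := by
        gcongr with x
        rw [kconv_eq]
        refine (enorm_integral_le_lintegral_enorm _).trans_eq ?_
        simp_rw [enorm_mul]
    _ ≤ (∫⁻ y, ‖k y‖ₑ) ^ (2 : ℝ) * ∫⁻ y, ‖k y‖ₑ * ∫⁻ x, ‖f (x - y)‖ₑ ^ (3 : ℝ) :=
        lintegral_lintegral_mul_rpow_three_le hk.enorm (aestronglyMeasurable_comp_sub hf).enorm
    _ = _ := by
        have : ∀ y, ∫⁻ x, ‖f (x - y)‖ₑ ^ (3 : ℝ) = ∫⁻ x, ‖f x‖ₑ ^ (3 : ℝ) := fun y =>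
          lintegral_sub_right_eq_self (fun x => ‖f x‖ₑ ^ (3 : ℝ)) y
        simp_rw [this]
        rw [lintegral_mul_const'' _ hk.enorm, ← mul_assoc]
        congr 1
        nth_rewrite 2 [← ENNReal.rpow_one (∫⁻ y, ‖k y‖ₑ)]
        rw [← ENNReal.rpow_add_of_nonneg _ _ (by norm_num) (by norm_num)]
        norm_num

/-- Measurable functions with Gaussian decay. -/
def GaussianDecay (k : R3 → ℝ) : Prop :=
  AEStronglyMeasurable k volume ∧ ∃ C c : ℝ, 0 < c ∧ ∀ z, |k z| ≤ C * Real.exp (-c * ‖z‖ ^ 2)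

lemma GaussianDecay.memLp {k : R3 → ℝ} (hk : GaussianDecay k) {p : ℝ≥0∞} (hp : 1 ≤ p) :
    MemLp k p := by
  obtain ⟨hm, C, c, hc, h⟩ := hk
  exact ((memLp_exp_neg_mul_sq_norm hc hp).const_mul C).mono' hm (ae_of_all _ h)

lemma GaussianDecay.integrable {k : R3 → ℝ} (hk : GaussianDecay k) : Integrable k :=
  memLp_one_iff_integrable.1 (hk.memLp le_rfl)

lemma GaussianDecay.memLp_sub {k : R3 → ℝ} (hk : GaussianDecay k) {p : ℝ≥0∞} (hp : 1 ≤ p)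
    (x : R3) : MemLp (fun y => k (x - y)) p :=
  (hk.memLp hp).comp_measurePreserving (Measure.measurePreserving_sub_left volume x)

lemma GaussianDecay.integrable_sub_mul {k f : R3 → ℝ} (hk : GaussianDecay k) {p : ℝ≥0∞}
    (hp : 1 ≤ p) (hf : MemLp f p) (x : R3) : Integrable (fun y => k (x - y) * f y) := by
  have := ENNReal.HolderConjugate.conjExponent hp
  exact (hk.memLp_sub (ENNReal.HolderConjugate.one_le p.conjExponent p) x).integrable_mul hf

lemma GaussianDecay.memLp_kconv {k f : R3 → ℝ} (hk : GaussianDecay k) (hf : MemLp f 3) :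
    MemLp (kconv k f) 3 := by
  refine ⟨aestronglyMeasurable_kconv hk.1 hf.1, ?_⟩
  exact (eLpNorm_kconv_le hk.1 hf.1).trans_lt (ENNReal.mul_lt_top hk.integrable.2 hf.2)

lemma gaussianDecay_heatKernel {t : ℝ} (ht : 0 < t) : GaussianDecay (heatKernel t) := by
  refine ⟨(contDiff_heatKernel t).continuous.aestronglyMeasurable,
    (4 * Real.pi * t) ^ (-(3 / 2) : ℝ), 1 / (4 * t), by positivity, fun z => ?_⟩
  rw [abs_of_pos (heatKernel_pos ht z), heatKernel_eq]

/-- Translations form a continuous family of measure-preserving maps, and composition with such a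
family is continuous in `L³`. -/
lemma tendsto_eLpNorm_sub_translate {f : R3 → ℝ} (hf : MemLp f 3) :
    Tendsto (fun y => eLpNorm (fun x => f x - f (x - y)) 3 volume) (𝓝 0) (𝓝 0) := by
  have : Fact ((1 : ℝ≥0∞) ≤ 3) := ⟨by norm_num⟩
  let F : C(R3 × R3, R3) := ⟨fun p => p.2 - p.1, by fun_prop⟩
  have hg : Tendsto (fun y => F.curry y) (𝓝 0) (𝓝 (F.curry 0)) := F.curry.continuous.tendsto 0
  have hmp : ∀ y, MeasurePreserving (F.curry y) (volume : Measure R3) volume := fun y =>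
    measurePreserving_sub_right volume y
  have h := (tendsto_const_nhds (x := hf.toLp f)).compMeasurePreservingLp hg hmp (hmp 0)
    (by norm_num)
  rw [tendsto_iff_edist_tendsto_0] at h
  refine h.congr fun y => ?_
  rw [Lp.toLp_compMeasurePreserving, Lp.toLp_compMeasurePreserving, Lp.edist_toLp_toLp,
    eLpNorm_sub_comm]
  congr 1
  ext x
  simp [F]

lemma setLIntegral_heatKernel_compl_ball_le {t δ : ℝ} (ht : 0 < t) (hδ : 0 < δ) :
    ∫⁻ y in (ball (0 : R3) δ)ᶜ, ENNReal.ofReal (heatKernel t y) ≤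
      ENNReal.ofReal (3 * Real.exp (-(δ ^ 2 / (8 * t)))) := by
  calc _ ≤ ∫⁻ y in (ball (0 : R3) δ)ᶜ, ENNReal.ofReal (3 * Real.exp (-(δ ^ 2 / (8 * t)))) *
        ENNReal.ofReal (heatKernel (2 * t) y) := by
        refine setLIntegral_mono' measurableSet_ball.compl fun y hy => ?_
        have hy' : δ ≤ ‖y‖ := by simpa using hy
        rw [← ENNReal.ofReal_mul (by positivity), heatKernel_eq_double ht]
        refine ENNReal.ofReal_le_ofReal ?_
        have := heatKernel_pos (show 0 < 2 * t by positivity) y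
        gcongr
        exact two_rpow_three_halves_le
    _ ≤ ∫⁻ y : R3, ENNReal.ofReal (3 * Real.exp (-(δ ^ 2 / (8 * t)))) *
        ENNReal.ofReal (heatKernel (2 * t) y) := setLIntegral_le_lintegral _ _
    _ = _ := by
        rw [lintegral_const_mul' _ _ ENNReal.ofReal_ne_top, lintegral_heatKernel (by positivity),
          mul_one]

lemma enorm_heatKernel {t : ℝ} (ht : 0 < t) (z : R3) :
    ‖heatKernel t z‖ₑ = ENNReal.ofReal (heatKernel t z) := by
  rw [Real.enorm_eq_ofReal (heatKernel_pos ht z).le]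

/-- The heat flow is continuous at time zero in `L³`. -/
lemma tendsto_eLpNorm_sub_heat_zero {f : R3 → ℝ} (hf : MemLp f 3) :
    Tendsto (fun t => eLpNorm (fun x => f x - kconv (heatKernel t) f x) 3 volume)
      (𝓝[>] 0) (𝓝 0) := by
  set modulus : R3 → ℝ≥0∞ := fun y => ∫⁻ x, ‖f x - f (x - y)‖ₑ ^ (3 : ℝ) with hmod
  have hmod0 : Tendsto modulus (𝓝 0) (𝓝 0) := by
    have := (tendsto_eLpNorm_sub_translate hf).ennrpow_const (3 : ℝ)
    rw [ENNReal.zero_rpow_of_pos (by norm_num)] at this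
    exact this.congr fun y => eLpNorm_three_rpow _
  set W : ℝ≥0∞ := (2 * eLpNorm f 3 volume) ^ (3 : ℝ) with hW
  have hWt : W ≠ ⊤ := ENNReal.rpow_ne_top_of_nonneg (by norm_num)
    (ENNReal.mul_ne_top (by norm_num) hf.2.ne)
  have hmodW : ∀ y, modulus y ≤ W := by
    intro y
    simp only [hmod, hW]
    rw [← eLpNorm_three_rpow]
    refine ENNReal.rpow_le_rpow ?_ (by norm_num)
    have hmp := measurePreserving_sub_right (volume : Measure R3) y
    refine (eLpNorm_sub_le hf.1 (hf.1.comp_measurePreserving hmp) (by norm_num)).trans_eq ?_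
    rw [eLpNorm_comp_measurePreserving hf.1 hmp, two_mul]
  have hbound : ∀ t > 0, eLpNorm (fun x => f x - kconv (heatKernel t) f x) 3 volume ≤
      (∫⁻ y, ENNReal.ofReal (heatKernel t y) * modulus y) ^ (1 / 3 : ℝ) := by
    intro t ht
    rw [eLpNorm_three_eq]
    refine ENNReal.rpow_le_rpow ?_ (by norm_num)
    have hH : AEMeasurable (Function.uncurry fun x y => ‖f x - f (x - y)‖ₑ)
        ((volume : Measure R3).prod (volume : Measure R3)) :=
      (hf.1.comp_fst.sub (aestronglyMeasurable_comp_sub hf.1)).enorm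
    have h2 := lintegral_lintegral_mul_rpow_three_le
      (integrable_heatKernel ht).1.aemeasurable.ennreal_ofReal hH
    rw [lintegral_heatKernel ht, ENNReal.one_rpow, one_mul] at h2
    refine le_trans (lintegral_mono fun x => ?_) h2
    refine ENNReal.rpow_le_rpow ?_ (by norm_num)
    -- The kernel has mass one, so the difference is an average of `f x - f (x - y)`.
    have e : f x - kconv (heatKernel t) f x = ∫ y, heatKernel t y * (f x - f (x - y)) := by
      simp_rw [mul_sub]
      rw [integral_sub ((integrable_heatKernel ht).mul_const _), integral_mul_const,
        integral_heatKernel ht, one_mul, kconv_eq]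
      have := (gaussianDecay_heatKernel ht).integrable_sub_mul (by norm_num) hf x
      rw [← integrable_comp_sub_left _ x] at this
      simpa using this
    rw [e]
    refine (enorm_integral_le_lintegral_enorm _).trans_eq ?_
    simp_rw [enorm_mul, enorm_heatKernel ht]
  have hI : Tendsto (fun t => ∫⁻ y, ENNReal.ofReal (heatKernel t y) * modulus y) (𝓝[>] 0) (𝓝 0) := by
    rw [ENNReal.tendsto_nhds_zero]
    intro η hη
    have hη2 : 0 < η / 2 := ENNReal.half_pos hη.ne'
    obtain ⟨δ, hδ, hball⟩ := Metric.eventually_nhds_iff_ball.1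
      ((ENNReal.tendsto_nhds_zero.1 hmod0) _ hη2)
    have htail : Tendsto (fun t : ℝ => W * ENNReal.ofReal (3 * Real.exp (-(δ ^ 2 / (8 * t)))))
        (𝓝[>] 0) (𝓝 0) := by
      have h1 : Tendsto (fun t : ℝ => 3 * Real.exp (-(δ ^ 2 / (8 * t)))) (𝓝[>] 0) (𝓝 0) := by
        have h2 : Tendsto (fun t : ℝ => δ ^ 2 / 8 * t⁻¹) (𝓝[>] 0) atTop :=
          tendsto_inv_nhdsGT_zero.const_mul_atTop (by positivity)
        have h3 := ((Real.tendsto_exp_neg_atTop_nhds_zero.comp h2).const_mul 3)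
        rw [mul_zero] at h3
        refine h3.congr fun t => ?_
        simp only [Function.comp]
        congr 3
        ring
      have h2 := ENNReal.Tendsto.const_mul (ENNReal.tendsto_ofReal h1) (Or.inr hWt)
      simpa using h2
    filter_upwards [(ENNReal.tendsto_nhds_zero.1 htail) _ hη2, self_mem_nhdsWithin] with t ht1 ht
    -- Near the origin the modulus of continuity is small; away from it the modulus is at most `W`
    -- and the kernel mass tends to zero.
    rw [← lintegral_add_compl _ (measurableSet_ball (x := (0 : R3)) (ε := δ)),
      ← ENNReal.add_halves η]
    refine add_le_add ?_ (le_trans ?_ ht1)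
    · calc _ ≤ ∫⁻ y in ball (0 : R3) δ, ENNReal.ofReal (heatKernel t y) * (η / 2) := by
            refine setLIntegral_mono' measurableSet_ball fun y hy => ?_
            gcongr
            exact hball y hy
        _ ≤ ∫⁻ y, ENNReal.ofReal (heatKernel t y) * (η / 2) := setLIntegral_le_lintegral _ _
        _ = η / 2 := by
            rw [lintegral_mul_const'' _ (integrable_heatKernel ht).1.aemeasurable.ennreal_ofReal,
              lintegral_heatKernel ht, one_mul]
    · calc _ ≤ ∫⁻ y in (ball (0 : R3) δ)ᶜ, W * ENNReal.ofReal (heatKernel t y) := by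
            refine lintegral_mono fun y => ?_
            rw [mul_comm]
            gcongr
            exact hmodW y
        _ ≤ _ := by
            rw [lintegral_const_mul' _ _ hWt]
            gcongr
            exact setLIntegral_heatKernel_compl_ball_le ht hδ
  have h3 := hI.ennrpow_const (1 / 3 : ℝ)
  rw [ENNReal.zero_rpow_of_pos (by norm_num)] at h3
  refine tendsto_of_tendsto_of_tendsto_of_le_of_le' tendsto_const_nhds h3
    (Eventually.of_forall fun _ => zero_le) ?_
  filter_upwards [self_mem_nhdsWithin] with t ht using hbound t ht

/-- Interpolation between the supremum `(4πt)^{-3/2}` and the mass one: the cube of the norm is at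
most the supremum squared. -/
lemma eLpNorm_heatKernel_le {t : ℝ} (ht : 0 < t) :
    eLpNorm (heatKernel t) 3 volume ≤ ENNReal.ofReal ((4 * Real.pi * t)⁻¹) := by
  rw [← ENNReal.rpow_le_rpow_iff (show (0 : ℝ) < 3 by norm_num), eLpNorm_three_rpow,
    ENNReal.ofReal_rpow_of_nonneg (by positivity) (by norm_num)]
  calc _ ≤ ∫⁻ z, ENNReal.ofReal (((4 * Real.pi * t)⁻¹) ^ (3 : ℝ)) *
        ENNReal.ofReal (heatKernel t z) := by
        refine lintegral_mono fun z => ?_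
        have h0 := heatKernel_pos ht z
        have h1 := heatKernel_le_sup ht z
        rw [enorm_heatKernel ht, ENNReal.ofReal_rpow_of_nonneg h0.le (by norm_num),
          ← ENNReal.ofReal_mul (by positivity)]
        refine ENNReal.ofReal_le_ofReal ?_
        have e : ((4 * Real.pi * t)⁻¹) ^ (3 : ℝ) = ((4 * Real.pi * t) ^ (-(3 / 2) : ℝ)) ^ 2 := by
          rw [← Real.rpow_natCast, ← Real.rpow_mul (by positivity),
            ← Real.rpow_neg_one (4 * Real.pi * t), ← Real.rpow_mul (by positivity)]
          norm_num
        have e' : heatKernel t z ^ (3 : ℝ) = heatKernel t z ^ 2 * heatKernel t z := by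
          rw [← pow_succ, ← Real.rpow_natCast]; norm_num
        rw [e, e']
        gcongr
    _ = _ := by
        rw [lintegral_const_mul' _ _ ENNReal.ofReal_ne_top, lintegral_heatKernel ht, mul_one]

/-- The heat flow tends to zero in `L³` for large times. -/
lemma tendsto_eLpNorm_heat_atTop {f : R3 → ℝ} (hf : MemLp f 3) :
    Tendsto (fun t => eLpNorm (kconv (heatKernel t) f) 3 volume) atTop (𝓝 0) := by
  rw [ENNReal.tendsto_nhds_zero]
  intro η hη
  have hη2 : 0 < η / 2 := ENNReal.half_pos hη.ne'
  -- An approximation `h` lies in `L¹`, so Young with the roles exchanged gives `‖h‖₁` times the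
  -- `L³` norm of the kernel, which decays; the flow does not increase the `L³` error `f - h`.
  obtain ⟨h, hsupp, hfh, hcont, hmem⟩ :=
    hf.exists_hasCompactSupport_eLpNorm_sub_le (by norm_num) hη2.ne'
  have hint : Integrable h := hcont.integrable_of_hasCompactSupport hsupp
  have hlim : Tendsto (fun t : ℝ => (∫⁻ y, ‖h y‖ₑ) * ENNReal.ofReal ((4 * Real.pi * t)⁻¹)) atTop
      (𝓝 0) := by
    have h1 : Tendsto (fun t : ℝ => (4 * Real.pi * t)⁻¹) atTop (𝓝 0) :=
      tendsto_inv_atTop_zero.comp (tendsto_id.const_mul_atTop (by positivity))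
    have h2 := ENNReal.Tendsto.const_mul (ENNReal.tendsto_ofReal h1) (Or.inr hint.2.ne)
    simpa using h2
  filter_upwards [(ENNReal.tendsto_nhds_zero.1 hlim) _ hη2, eventually_gt_atTop 0] with t ht1 ht
  have hk := gaussianDecay_heatKernel ht
  have e : kconv (heatKernel t) f = kconv (heatKernel t) (f - h) + kconv (heatKernel t) h := by
    ext x
    rw [Pi.add_apply]
    unfold kconv
    rw [← integral_add (hk.integrable_sub_mul (by norm_num) (hf.sub hmem) x)
      (hk.integrable_sub_mul (by norm_num) hmem x)]
    congr 1
    ext y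
    simp only [Pi.sub_apply]
    ring
  rw [e, ← ENNReal.add_halves η]
  refine (eLpNorm_add_le (hk.memLp_kconv (hf.sub hmem)).1 (hk.memLp_kconv hmem).1
    (by norm_num)).trans (add_le_add ?_ ?_)
  · refine (eLpNorm_kconv_le hk.1 (hf.sub hmem).1).trans ?_
    simp_rw [enorm_heatKernel ht]
    rwa [lintegral_heatKernel ht, one_mul]
  · rw [kconv_comm]
    refine (eLpNorm_kconv_le hint.1 hk.1).trans (le_trans ?_ ht1)
    gcongr
    exact eLpNorm_heatKernel_le ht

/-! ### Fubini for Gaussian kernels and for their time integrals -/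

/-- Hölder's bound is independent of `x` by translation invariance; this uniformity gives joint
integrability against any integrable `u`. -/
lemma GaussianDecay.exists_integral_abs_le {k f : R3 → ℝ} (hk : GaussianDecay k) {p : ℝ≥0∞}
    (hp : 1 ≤ p) (hf : MemLp f p) : ∃ M : ℝ, ∀ x, ∫ y, ‖k (x - y) * f y‖ ≤ M := by
  have := ENNReal.HolderConjugate.conjExponent hp
  have hq : 1 ≤ p.conjExponent := ENNReal.HolderConjugate.one_le p.conjExponent p
  refine ⟨(eLpNorm k p.conjExponent volume * eLpNorm f p volume).toReal, fun x => ?_⟩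
  have hmp := Measure.measurePreserving_sub_left (volume : Measure R3) x
  have h1 : eLpNorm (fun y => k (x - y) * f y) 1 volume ≤
      eLpNorm k p.conjExponent volume * eLpNorm f p volume := by
    have : ENNReal.HolderTriple p.conjExponent p 1 := this.symm
    have h := eLpNorm_smul_le_mul_eLpNorm (p := p.conjExponent) (q := p) (r := 1) hf.1
      (hk.1.comp_measurePreserving hmp)
    rwa [eLpNorm_comp_measurePreserving hk.1 hmp] at h
  rw [integral_norm_eq_lintegral_enorm (hk.integrable_sub_mul hp hf x).1,
    ← eLpNorm_one_eq_lintegral_enorm]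
  exact ENNReal.toReal_mono (ENNReal.mul_ne_top (hk.memLp hq).2.ne hf.2.ne) h1

lemma GaussianDecay.integrable_prod {k f u : R3 → ℝ} (hk : GaussianDecay k) {p : ℝ≥0∞}
    (hp : 1 ≤ p) (hf : MemLp f p) (hu : Integrable u) :
    Integrable (fun q : R3 × R3 => k (q.1 - q.2) * f q.2 * u q.1) (volume.prod volume) := by
  have hm : AEStronglyMeasurable (fun q : R3 × R3 => k (q.1 - q.2) * f q.2 * u q.1)
      (volume.prod volume) :=
    ((aestronglyMeasurable_comp_sub hk.1).mul hf.1.comp_snd).mul hu.1.comp_fst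
  rw [integrable_prod_iff hm]
  refine ⟨ae_of_all _ fun x => (hk.integrable_sub_mul hp hf x).mul_const (u x), ?_⟩
  obtain ⟨M, hM⟩ := hk.exists_integral_abs_le hp hf
  refine (hu.norm.const_mul M).mono' hm.norm.integral_prod_right' (ae_of_all _ fun x => ?_)
  rw [Real.norm_of_nonneg (integral_nonneg fun _ => norm_nonneg _)]
  simp_rw [norm_mul _ (u x)]
  rw [integral_mul_const]
  gcongr
  exact hM x

/-- Convolution with an even (`s = 1`) or odd (`s = -1`) kernel is symmetric or antisymmetric. -/
lemma GaussianDecay.integral_kconv_mul {k f u : R3 → ℝ} (hk : GaussianDecay k) {p : ℝ≥0∞}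
    (hp : 1 ≤ p) (hf : MemLp f p) (hu : Integrable u) {s : ℝ} (hs : ∀ z, k (-z) = s * k z) :
    ∫ x, kconv k f x * u x = s * ∫ y, f y * kconv k u y := by
  have hint := hk.integrable_prod hp hf hu
  calc ∫ x, kconv k f x * u x = ∫ x, ∫ y, k (x - y) * f y * u x := by
        simp_rw [kconv, integral_mul_const]
    _ = ∫ y, ∫ x, k (x - y) * f y * u x := integral_integral_swap hint
    _ = ∫ y, s * (f y * kconv k u y) := by
        refine integral_congr_ae (ae_of_all _ fun y => ?_)
        simp only [kconv]
        rw [← integral_const_mul, ← integral_const_mul]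
        congr 1
        ext x
        rw [← neg_sub y x, hs]
        ring
    _ = _ := integral_const_mul _ _

/-- The integral over the times `[ε, T]` of a time dependent kernel. -/
noncomputable def timeIntegral (ε T : ℝ) (F : ℝ → R3 → ℝ) (z : R3) : ℝ := ∫ t in Icc ε T, F t z

section timeIntegral

variable {ε T C c : ℝ} {F : ℝ → R3 → ℝ}

lemma gaussianDecay_timeIntegral (hF : Measurable (Function.uncurry F)) (hc : 0 < c)
    (hb : ∀ t ∈ Icc ε T, ∀ z, |F t z| ≤ C * Real.exp (-c * ‖z‖ ^ 2)) :
    GaussianDecay (timeIntegral ε T F) := by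
  have hm : StronglyMeasurable (fun q : R3 × ℝ => F q.2 q.1) :=
    (hF.comp measurable_swap).stronglyMeasurable
  refine ⟨hm.integral_prod_right'.aestronglyMeasurable,
    C * (volume : Measure ℝ).real (Icc ε T), c, hc, fun z => ?_⟩
  refine (norm_setIntegral_le_of_norm_le_const (f := fun t => F t z)
    (C := C * Real.exp (-c * ‖z‖ ^ 2)) measure_Icc_lt_top fun t ht => hb t ht z).trans_eq ?_
  ring

lemma integrable_time_space (hF : Measurable (Function.uncurry F)) (hc : 0 < c)
    (hb : ∀ t ∈ Icc ε T, ∀ z, |F t z| ≤ C * Real.exp (-c * ‖z‖ ^ 2)) {p : ℝ≥0∞} (hp : 1 ≤ p)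
    {f : R3 → ℝ} (hf : MemLp f p) (x : R3) :
    Integrable (fun q : ℝ × R3 => F q.1 (x - q.2) * f q.2)
      ((volume.restrict (Icc ε T)).prod volume) := by
  have hg : GaussianDecay fun z => C * Real.exp (-c * ‖z‖ ^ 2) := by
    refine ⟨(by fun_prop : Continuous fun z : R3 =>
      C * Real.exp (-c * ‖z‖ ^ 2)).aestronglyMeasurable, |C|, c, hc, fun z => ?_⟩
    rw [abs_mul, Real.abs_exp]
  have hdom : Integrable (fun q : ℝ × R3 => ‖C * Real.exp (-c * ‖x - q.2‖ ^ 2) * f q.2‖)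
      ((volume.restrict (Icc ε T)).prod volume) :=
    (hg.integrable_sub_mul hp hf x).norm.comp_snd (μ := volume.restrict (Icc ε T))
  have hm : AEStronglyMeasurable (fun q : ℝ × R3 => F q.1 (x - q.2) * f q.2)
      ((volume.restrict (Icc ε T)).prod volume) := by
    refine AEStronglyMeasurable.mul ?_ hf.1.comp_snd
    have : Measurable fun q : ℝ × R3 => (q.1, x - q.2) := by fun_prop
    exact (hF.comp this).aestronglyMeasurable
  refine hdom.mono' hm ?_
  have hae : ∀ᵐ t ∂(volume.restrict (Icc ε T)), t ∈ Icc ε T := ae_restrict_mem measurableSet_Icc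
  filter_upwards [(Measure.quasiMeasurePreserving_fst
    (μ := volume.restrict (Icc ε T)) (ν := (volume : Measure R3))).ae hae] with q hq
  rw [norm_mul, norm_mul]
  gcongr
  exact (hb _ hq _).trans (le_abs_self _)

lemma kconv_timeIntegral (hF : Measurable (Function.uncurry F)) (hc : 0 < c)
    (hb : ∀ t ∈ Icc ε T, ∀ z, |F t z| ≤ C * Real.exp (-c * ‖z‖ ^ 2)) {p : ℝ≥0∞} (hp : 1 ≤ p)
    {f : R3 → ℝ} (hf : MemLp f p) (x : R3) :
    kconv (timeIntegral ε T F) f x = ∫ t in Icc ε T, kconv (F t) f x := by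
  simp_rw [kconv, timeIntegral, ← integral_mul_const]
  exact (integral_integral_swap (integrable_time_space hF hc hb hp hf x)).symm

lemma integrableOn_kconv (hF : Measurable (Function.uncurry F)) (hc : 0 < c)
    (hb : ∀ t ∈ Icc ε T, ∀ z, |F t z| ≤ C * Real.exp (-c * ‖z‖ ^ 2)) {p : ℝ≥0∞} (hp : 1 ≤ p)
    {f : R3 → ℝ} (hf : MemLp f p) (x : R3) :
    IntegrableOn (fun t => kconv (F t) f x) (Icc ε T) :=
  (integrable_time_space hF hc hb hp hf x).integral_prod_left

end timeIntegral

/-! ### Weak derivatives of heat convolutions -/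

lemma gaussianDecay_heatKernelD (j : Fin 3) {t : ℝ} (ht : 0 < t) :
    GaussianDecay (heatKernelD j t) := by
  obtain ⟨C, hC⟩ := exists_abs_heatKernelD_le (T := t) ht j
  exact ⟨(contDiff_heatKernelD j t).continuous.aestronglyMeasurable, C, _, by positivity,
    hC t ⟨le_rfl, le_rfl⟩⟩

lemma gaussianDecay_heatKernelDD (i j : Fin 3) {t : ℝ} (ht : 0 < t) :
    GaussianDecay (heatKernelDD i j t) := by
  obtain ⟨C, hC⟩ := exists_abs_heatKernelDD_le (T := t) ht i j
  exact ⟨(continuous_heatKernelDD i j t).aestronglyMeasurable, C, _, by positivity,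
    hC t ⟨le_rfl, le_rfl⟩⟩

lemma heatKernelDD_neg (i j : Fin 3) (t : ℝ) (z : R3) :
    heatKernelDD i j t (-z) = heatKernelDD i j t z := by
  simp only [heatKernelDD, heatKernel_neg, PiLp.neg_apply]; ring

lemma partialDeriv_comp_const_sub (i : Fin 3) {k : R3 → ℝ} (hk : Differentiable ℝ k) (x y : R3) :
    partialDeriv i (fun y => k (x - y)) y = - partialDeriv i k (x - y) := by
  have h : HasFDerivAt (fun y => k (x - y)) _ y :=
    (hk (x - y)).hasFDerivAt.comp y ((hasFDerivAt_id y).const_sub x)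
  unfold partialDeriv
  rw [h.fderiv]
  simp

lemma IsTestFunction.integrable {u : R3 → ℝ} (hu : IsTestFunction u) : Integrable u :=
  hu.1.continuous.integrable_of_hasCompactSupport hu.2

lemma IsTestFunction.continuous_partialDeriv {u : R3 → ℝ} (hu : IsTestFunction u) (i : Fin 3) :
    Continuous (partialDeriv i u) :=
  (hu.1.continuous_fderiv (by simp)).clm_apply continuous_const

lemma IsTestFunction.integrable_partialDeriv {u : R3 → ℝ} (hu : IsTestFunction u) (i : Fin 3) :
    Integrable (partialDeriv i u) :=
  (hu.continuous_partialDeriv i).integrable_of_hasCompactSupport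
    (hu.2.fderiv_apply (𝕜 := ℝ) (EuclideanSpace.single i 1))

/-- Derivatives of a convolution can be moved from one factor to the other. -/
lemma kconv_heatKernelD_partialDeriv (i j : Fin 3) {t : ℝ} (ht : 0 < t) {u : R3 → ℝ}
    (hu : IsTestFunction u) (x : R3) :
    kconv (heatKernelD j t) (partialDeriv i u) x = kconv (heatKernelDD i j t) u x := by
  have hu1 : MemLp u 1 := memLp_one_iff_integrable.2 hu.integrable
  have hu2 : MemLp (partialDeriv i u) 1 :=
    memLp_one_iff_integrable.2 (hu.integrable_partialDeriv i)
  have hd : ∀ y, fderiv ℝ (fun y => heatKernelD j t (x - y)) y (EuclideanSpace.single i 1) =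
      - heatKernelDD i j t (x - y) := by
    intro y
    have := partialDeriv_comp_const_sub i
      ((contDiff_heatKernelD j t).differentiable (by simp)) x y
    rwa [partialDeriv_heatKernelD i j ht] at this
  have h1 := (gaussianDecay_heatKernelDD i j ht).integrable_sub_mul le_rfl hu1 x
  have h := integral_mul_fderiv_eq_neg_fderiv_mul_of_integrable (μ := (volume : Measure R3))
    (f := fun y => heatKernelD j t (x - y)) (g := u) (v := EuclideanSpace.single i 1)
    (by simp_rw [hd, neg_mul]; exact h1.neg)
    ((gaussianDecay_heatKernelD j ht).integrable_sub_mul le_rfl hu2 x)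
    ((gaussianDecay_heatKernelD j ht).integrable_sub_mul le_rfl hu1 x)
    (fun y _ => (((contDiff_heatKernelD j t).comp (contDiff_const.sub contDiff_id)).differentiable
      (by simp)) y)
    (fun y _ => (hu.1.differentiable (by simp)) y)
  simp_rw [hd, neg_mul] at h
  rw [integral_neg, neg_neg] at h
  exact h

section weakDerivative

variable {ε T : ℝ}

lemma gaussianDecay_timeIntegral_heatKernelD (hε : 0 < ε) (hT : 0 < T) (j : Fin 3) :
    GaussianDecay (timeIntegral ε T (heatKernelD j)) := by
  obtain ⟨C, hC⟩ := exists_abs_heatKernelD_le (T := T) hε j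
  exact gaussianDecay_timeIntegral (measurable_heatKernelD j) (by positivity) hC

lemma gaussianDecay_timeIntegral_heatKernelDD (hε : 0 < ε) (hT : 0 < T) (i j : Fin 3) :
    GaussianDecay (timeIntegral ε T (heatKernelDD i j)) := by
  obtain ⟨C, hC⟩ := exists_abs_heatKernelDD_le (T := T) hε i j
  exact gaussianDecay_timeIntegral (measurable_heatKernelDD i j) (by positivity) hC

lemma kconv_timeIntegral_partialDeriv (hε : 0 < ε) (hT : 0 < T) (i j : Fin 3) {u : R3 → ℝ}
    (hu : IsTestFunction u) (x : R3) :
    kconv (timeIntegral ε T (heatKernelD j)) (partialDeriv i u) x =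
      kconv (timeIntegral ε T (heatKernelDD i j)) u x := by
  obtain ⟨C, hC⟩ := exists_abs_heatKernelD_le (T := T) hε j
  obtain ⟨C', hC'⟩ := exists_abs_heatKernelDD_le (T := T) hε i j
  rw [kconv_timeIntegral (measurable_heatKernelD j) (by positivity) hC le_rfl
    (memLp_one_iff_integrable.2 (hu.integrable_partialDeriv i)),
    kconv_timeIntegral (measurable_heatKernelDD i j) (by positivity) hC' le_rfl
    (memLp_one_iff_integrable.2 hu.integrable)]
  refine setIntegral_congr_fun measurableSet_Icc fun t ht => ?_
  exact kconv_heatKernelD_partialDeriv i j (hε.trans_le ht.1) hu x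

/-- By duality: the even second-derivative kernel and the odd first-derivative kernel are both moved
onto the test function, where integration by parts is classical. The oddness produces the minus
sign. -/
lemma integral_kconv_timeIntegral_mul (hε : 0 < ε) (hT : 0 < T) (i j : Fin 3) {f u : R3 → ℝ}
    (hf : MemLp f 3) (hu : IsTestFunction u) :
    ∫ x, kconv (timeIntegral ε T (heatKernelDD i j)) f x * u x =
      - ∫ x, kconv (timeIntegral ε T (heatKernelD j)) f x * partialDeriv i u x := by
  rw [(gaussianDecay_timeIntegral_heatKernelDD hε hT i j).integral_kconv_mul (by norm_num) hf
      hu.integrable (s := 1) (fun z => by simp [timeIntegral, heatKernelDD_neg]),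
    (gaussianDecay_timeIntegral_heatKernelD hε hT j).integral_kconv_mul (by norm_num) hf
      (hu.integrable_partialDeriv i) (s := -1)
      (fun z => by simp [timeIntegral, heatKernelD_neg, integral_neg])]
  simp_rw [kconv_timeIntegral_partialDeriv hε hT i j hu]
  ring

end weakDerivative

/-! ### The scalar potential and its weak gradient -/

lemma memLp_coord {A : R3 → R3} {p : ℝ≥0∞} (hA : MemLp A p) (i : Fin 3) :
    MemLp (fun x => A x i) p :=
  hA.mono ((EuclideanSpace.proj i : R3 →L[ℝ] ℝ).continuous.comp_aestronglyMeasurable hA.1)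
    (ae_of_all _ fun x => PiLp.norm_apply_le (A x) i)

lemma memLp_of_coord {G : R3 → R3} {p : ℝ≥0∞} (hG : ∀ i, MemLp (fun x => G x i) p) :
    MemLp G p := by
  have h : MemLp (fun x => ∑ i : Fin 3, G x i • (EuclideanSpace.single i (1 : ℝ) : R3)) p :=
    memLp_finsetSum _ fun i _ => by
      have h := ((ContinuousLinearMap.id ℝ ℝ).smulRight
        (EuclideanSpace.single i (1 : ℝ) : R3)).comp_memLp' (hG i)
      exact h
  refine h.ae_eq (ae_of_all _ fun x => ?_)
  ext j
  simp [Fin.sum_univ_three]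
  fin_cases j <;> simp

/-- The scalar potential whose gradient is removed from `A`. -/
noncomputable def heatPotential (ε T : ℝ) (A : R3 → R3) (x : R3) : ℝ :=
  - ∑ j, kconv (timeIntegral ε T (heatKernelD j)) (fun y => A y j) x

/-- The gradient of `heatPotential`. -/
noncomputable def heatPotentialGrad (ε T : ℝ) (A : R3 → R3) (x : R3) : R3 :=
  WithLp.toLp 2 fun i => - ∑ j, kconv (timeIntegral ε T (heatKernelDD i j)) (fun y => A y j) x

lemma memLp_heatPotentialGrad {ε T : ℝ} (hε : 0 < ε) (hT : 0 < T) {A : R3 → R3} (hA : MemLp A 3) :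
    MemLp (heatPotentialGrad ε T A) 3 := by
  refine memLp_of_coord fun i => ?_
  exact (memLp_finsetSum _ fun j _ =>
    (gaussianDecay_timeIntegral_heatKernelDD hε hT i j).memLp_kconv (memLp_coord hA j)).neg

lemma memLp_heatPotential {ε T : ℝ} (hε : 0 < ε) (hT : 0 < T) {A : R3 → R3} (hA : MemLp A 3) :
    MemLp (heatPotential ε T A) 3 :=
  (memLp_finsetSum _ fun j _ =>
    (gaussianDecay_timeIntegral_heatKernelD hε hT j).memLp_kconv (memLp_coord hA j)).neg

lemma integrable_mul_of_hasCompactSupport {f u : R3 → ℝ} (hf : MemLp f 3) (hu : Continuous u)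
    (hs : HasCompactSupport u) : Integrable (fun x => f x * u x) := by
  have : ENNReal.HolderConjugate 3 (ENNReal.conjExponent 3) := .conjExponent (by norm_num)
  exact hf.integrable_mul (q := ENNReal.conjExponent 3) (hu.memLp_of_hasCompactSupport hs)

lemma hasWeakGradient_heatPotential {ε T : ℝ} (hε : 0 < ε) (hT : 0 < T) {A : R3 → R3}
    (hA : MemLp A 3) : HasWeakGradient (heatPotential ε T A) (heatPotentialGrad ε T A) := by
  refine ⟨(memLp_heatPotential hε hT hA).locallyIntegrable (by norm_num),
    (memLp_heatPotentialGrad hε hT hA).locallyIntegrable (by norm_num), fun u hu i => ?_⟩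
  simp only [heatPotential, heatPotentialGrad, neg_mul, Finset.sum_mul]
  rw [integral_neg, integral_neg, integral_finsetSum, integral_finsetSum,
    ← Finset.sum_neg_distrib, ← Finset.sum_neg_distrib, ← Finset.sum_neg_distrib]
  · refine Finset.sum_congr rfl fun j _ => ?_
    rw [integral_kconv_timeIntegral_mul hε hT i j (memLp_coord hA j) hu]
  · intro j _
    exact integrable_mul_of_hasCompactSupport
      ((gaussianDecay_timeIntegral_heatKernelD hε hT j).memLp_kconv (memLp_coord hA j))
      (hu.continuous_partialDeriv i) (hu.2.fderiv_apply (𝕜 := ℝ) (EuclideanSpace.single i 1))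
  · intro j _
    exact integrable_mul_of_hasCompactSupport
      ((gaussianDecay_timeIntegral_heatKernelDD hε hT i j).memLp_kconv (memLp_coord hA j))
      hu.1.continuous hu.2

/-! ### The weak curl tested against heat kernels -/

/-- There is a sequence of cut-off functions, with gradients tending uniformly to zero. -/
lemma exists_cutoff : ∃ (χ : ℕ → R3 → ℝ) (M : ℝ), (∀ n, IsTestFunction (χ n)) ∧
    (∀ n y, |χ n y| ≤ 1) ∧ (∀ y, Tendsto (fun n => χ n y) atTop (𝓝 1)) ∧
    (∀ n i y, |partialDeriv i (χ n) y| ≤ M * ((n : ℝ) + 1)⁻¹) := by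
  -- A single bump is evaluated at `y / (n + 1)`, and the chain rule supplies the small gradient
  -- factor; `n + 1` avoids division by zero.
  let b : ContDiffBump (0 : R3) := ⟨1, 2, one_pos, one_lt_two⟩
  have hb : ContDiff ℝ ∞ (b : R3 → ℝ) := b.contDiff
  obtain ⟨M, hM⟩ := (hb.continuous_fderiv (by simp)).bounded_above_of_compact_support
    (b.hasCompactSupport.fderiv (𝕜 := ℝ))
  have hpos : ∀ n : ℕ, (0 : ℝ) < ((n : ℝ) + 1)⁻¹ := fun n => by positivity
  refine ⟨fun n y => b (((n : ℝ) + 1)⁻¹ • y), M, fun n => ⟨?_, ?_⟩, fun n y => ?_, fun y => ?_,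
    fun n i y => ?_⟩
  · exact hb.comp (contDiff_const_smul _)
  · exact b.hasCompactSupport.comp_smul (hpos n).ne'
  · rw [abs_of_nonneg b.nonneg]
    exact b.le_one
  · refine tendsto_const_nhds.congr' ?_
    obtain ⟨N, hN⟩ := exists_nat_ge ‖y‖
    filter_upwards [eventually_ge_atTop N] with n hn
    refine (b.one_of_mem_closedBall ?_).symm
    rw [mem_closedBall_zero_iff, norm_smul, Real.norm_of_nonneg (hpos n).le,
      inv_mul_le_iff₀ (by positivity)]
    have : (N : ℝ) ≤ n := by exact_mod_cast hn
    change ‖y‖ ≤ ((n : ℝ) + 1) * 1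
    linarith
  · have h : HasFDerivAt (fun y => b (((n : ℝ) + 1)⁻¹ • y)) _ y :=
      ((hb.differentiable (by simp)) (((n : ℝ) + 1)⁻¹ • y)).hasFDerivAt.comp y
        ((hasFDerivAt_id y).const_smul ((n : ℝ) + 1)⁻¹)
    unfold partialDeriv
    rw [h.fderiv]
    simp only [ContinuousLinearMap.comp_apply, smul_apply, ContinuousLinearMap.id_apply, map_smul,
      smul_eq_mul]
    rw [abs_mul, abs_of_pos (hpos n), mul_comm]
    gcongr
    refine ((fderiv ℝ (b : R3 → ℝ) _).le_opNorm _).trans ?_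
    simpa using hM _

lemma partialDeriv_mul (i : Fin 3) {f g : R3 → ℝ} (hf : ContDiff ℝ ∞ f) (hg : ContDiff ℝ ∞ g)
    (y : R3) : partialDeriv i (fun y => f y * g y) y =
      f y * partialDeriv i g y + g y * partialDeriv i f y := by
  unfold partialDeriv
  rw [fderiv_fun_mul ((hf.differentiable (by simp)) y) ((hg.differentiable (by simp)) y)]
  simp

/-- The weak curl identity for test functions without compact support. -/
lemma HasWeakCurl.integral_mul_eq {A B : R3 → R3} (h : HasWeakCurl A B) {u : R3 → ℝ}
    (hu : ContDiff ℝ ∞ u) (hBu : ∀ i, Integrable fun y => B y i * u y)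
    (hAu : ∀ i, Integrable fun y => A y i * u y)
    (hAdu : ∀ i j, Integrable fun y => A y i * partialDeriv j u y) (i : Fin 3) :
    ∫ y, B y i * u y = - ∫ y, (A y (i + 2) * partialDeriv (i + 1) u y
      - A y (i + 1) * partialDeriv (i + 2) u y) := by
  obtain ⟨χ, M, htest, hle, hlim, hgrad⟩ := exists_cutoff
  have hM : 0 ≤ M := by
    have := (abs_nonneg _).trans (hgrad 0 0 0)
    simpa using this
  have htest' : ∀ n, IsTestFunction (fun y => χ n y * u y) := fun n =>
    ⟨(htest n).1.mul hu, (htest n).2.mul_right⟩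
  have hgrad1 : ∀ n i y, |partialDeriv i (χ n) y| ≤ M := by
    intro n i y
    refine (hgrad n i y).trans (mul_le_of_le_one_right hM (inv_le_one_of_one_le₀ ?_))
    have : (0 : ℝ) ≤ n := n.cast_nonneg
    linarith
  have hgrad0 : ∀ i y, Tendsto (fun n => partialDeriv i (χ n) y) atTop (𝓝 0) := by
    intro i y
    have h0 : Tendsto (fun n : ℕ => M * ((n : ℝ) + 1)⁻¹) atTop (𝓝 0) := by
      have := (tendsto_one_div_add_atTop_nhds_zero_nat (𝕜 := ℝ)).const_mul M
      simpa using this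
    exact squeeze_zero_norm (fun n => hgrad n i y) h0
  have hmul : ∀ n j y, partialDeriv j (fun y => χ n y * u y) y =
      χ n y * partialDeriv j u y + u y * partialDeriv j (χ n) y := fun n j y =>
    partialDeriv_mul j (htest n).1 hu y
  have hl : Tendsto (fun n => ∫ y, B y i * (χ n y * u y)) atTop (𝓝 (∫ y, B y i * u y)) := by
    refine tendsto_integral_of_dominated_convergence (fun y => ‖B y i * u y‖) (fun n => ?_)
      (hBu i).norm (fun n => ae_of_all _ fun y => ?_) (ae_of_all _ fun y => ?_)
    · have := (hBu i).1.mul (htest n).1.continuous.aestronglyMeasurable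
      refine this.congr (ae_of_all _ fun y => ?_)
      simp only [Pi.mul_apply]
      ring
    · rw [mul_left_comm, norm_mul]
      exact mul_le_of_le_one_left (norm_nonneg _) (hle n y)
    · have := ((hlim y).mul_const (u y)).const_mul (B y i)
      rwa [one_mul] at this
  -- The product rule adds an error `u ∂ⱼχₙ`, which tends to zero pointwise and is dominated by `M
  -- |u|`; hence the integrability assumption on `A u`.
  have key : ∀ a j, Tendsto (fun n => ∫ y, A y a * partialDeriv j (fun y => χ n y * u y) y) atTop
      (𝓝 (∫ y, A y a * partialDeriv j u y)) ∧
      ∀ n, Integrable fun y => A y a * partialDeriv j (fun y => χ n y * u y) y := by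
    intro a j
    have hint : Integrable fun y => ‖A y a * partialDeriv j u y‖ + M * ‖A y a * u y‖ :=
      (hAdu a j).norm.add ((hAu a).norm.const_mul M)
    have hmeas : ∀ n, AEStronglyMeasurable
        (fun y => A y a * partialDeriv j (fun y => χ n y * u y) y) volume := by
      intro n
      have := ((hAdu a j).1.mul (htest n).1.continuous.aestronglyMeasurable).add
        ((hAu a).1.mul ((htest n).continuous_partialDeriv j).aestronglyMeasurable)
      refine this.congr (ae_of_all _ fun y => ?_)
      simp only [Pi.mul_apply, Pi.add_apply, hmul]
      ring
    have hbd : ∀ n y, ‖A y a * partialDeriv j (fun y => χ n y * u y) y‖ ≤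
        ‖A y a * partialDeriv j u y‖ + M * ‖A y a * u y‖ := by
      intro n y
      have e : A y a * partialDeriv j (fun y => χ n y * u y) y =
          χ n y * (A y a * partialDeriv j u y) + partialDeriv j (χ n) y * (A y a * u y) := by
        rw [hmul]; ring
      rw [e]
      refine (norm_add_le _ _).trans (add_le_add ?_ ?_)
      · rw [norm_mul]
        exact mul_le_of_le_one_left (norm_nonneg _) (hle n y)
      · rw [norm_mul]
        gcongr
        exact hgrad1 n j y
    refine ⟨?_, fun n => hint.mono' (hmeas n) (ae_of_all _ (hbd n))⟩
    refine tendsto_integral_of_dominated_convergence _ hmeas hint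
      (fun n => ae_of_all _ (hbd n)) (ae_of_all _ fun y => ?_)
    have := (((hlim y).mul_const (partialDeriv j u y)).add
      ((hgrad0 j y).const_mul (u y))).const_mul (A y a)
    rw [one_mul, mul_zero, add_zero] at this
    exact this.congr fun n => by rw [hmul]
  have hr : Tendsto (fun n => - ∫ y, (A y (i + 2) * partialDeriv (i + 1) (fun y => χ n y * u y) y
      - A y (i + 1) * partialDeriv (i + 2) (fun y => χ n y * u y) y)) atTop
      (𝓝 (- ∫ y, (A y (i + 2) * partialDeriv (i + 1) u y
      - A y (i + 1) * partialDeriv (i + 2) u y))) := by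
    rw [integral_sub (hAdu _ _) (hAdu _ _)]
    refine (((key (i + 2) (i + 1)).1.sub (key (i + 1) (i + 2)).1).neg).congr fun n => ?_
    rw [integral_sub ((key _ _).2 n) ((key _ _).2 n)]
  refine tendsto_nhds_unique hl (hr.congr fun n => ?_)
  exact (h.2.2 _ (htest' n) i).symm

/-- Test functions determine a locally integrable field almost everywhere. This transfers `L^{3/2}`
membership between representatives of the curl. -/
lemma HasWeakCurl.ae_eq {A B B' : R3 → R3} (h : HasWeakCurl A B) (h' : HasWeakCurl A B') :
    B =ᵐ[volume] B' := by
  have hli : ∀ {D : R3 → R3}, LocallyIntegrable D volume → ∀ i,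
      LocallyIntegrable (fun x => D x i) volume := by
    intro D hD i
    refine hD.mono ((EuclideanSpace.proj i : R3 →L[ℝ] ℝ).continuous.comp_aestronglyMeasurable
      hD.aestronglyMeasurable) (ae_of_all _ fun x => PiLp.norm_apply_le (D x) i)
  have hi : ∀ i, ∀ᵐ x, B x i = B' x i := by
    intro i
    refine ae_eq_of_integral_contDiff_smul_eq (hli h.2.1 i) (hli h'.2.1 i) fun g hg hs => ?_
    have e := (h.2.2 g ⟨hg, hs⟩ i).trans (h'.2.2 g ⟨hg, hs⟩ i).symm
    simpa only [smul_eq_mul, mul_comm] using e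
  filter_upwards [ae_all_iff.2 hi] with x hx
  ext i
  exact hx i

lemma one_le_three_halves : (1 : ℝ≥0∞) ≤ 3 / 2 := by
  rw [ENNReal.le_div_iff_mul_le (by simp) (by simp)]
  norm_num

/-- The weak curl identity tested with derivatives of the heat kernel. -/
lemma kconv_heatKernelD_curl {A B : R3 → R3} (hA : MemLp A 3) (hB : MemLp B (3 / 2))
    (h : HasWeakCurl A B) (i j : Fin 3) {t : ℝ} (ht : 0 < t) (x : R3) :
    kconv (heatKernelD j t) (fun y => B y i) x =
      kconv (heatKernelDD (i + 1) j t) (fun y => A y (i + 2)) x -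
      kconv (heatKernelDD (i + 2) j t) (fun y => A y (i + 1)) x := by
  have hd : ∀ a y, partialDeriv a (fun y => heatKernelD j t (x - y)) y =
      - heatKernelDD a j t (x - y) := by
    intro a y
    rw [partialDeriv_comp_const_sub a ((contDiff_heatKernelD j t).differentiable (by simp)) x y,
      partialDeriv_heatKernelD a j ht]
  have hint : ∀ a b, Integrable fun y => A y a * heatKernelDD b j t (x - y) := fun a b => by
    have := (gaussianDecay_heatKernelDD b j ht).integrable_sub_mul (by norm_num)
      (memLp_coord hA a) x
    simpa only [mul_comm] using this
  have hintA : ∀ a, Integrable fun y => A y a * heatKernelD j t (x - y) := fun a => by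
    have := (gaussianDecay_heatKernelD j ht).integrable_sub_mul (by norm_num) (memLp_coord hA a) x
    simpa only [mul_comm] using this
  have hintB : ∀ a, Integrable fun y => B y a * heatKernelD j t (x - y) := fun a => by
    have := (gaussianDecay_heatKernelD j ht).integrable_sub_mul one_le_three_halves
      (memLp_coord hB a) x
    simpa only [mul_comm] using this
  -- The test function `y ↦ ∂ⱼ hₜ(x - y)`, with `hₜ` the heat kernel, lacks compact support, so the
  -- extended curl identity is needed.
  have h1 := h.integral_mul_eq (u := fun y => heatKernelD j t (x - y))
    ((contDiff_heatKernelD j t).comp (contDiff_const.sub contDiff_id)) hintB hintA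
    (fun a b => by
      simp_rw [hd, mul_neg]
      exact (hint a b).neg) i
  simp_rw [hd, mul_neg, neg_sub_neg] at h1
  rw [integral_sub (hint _ _) (hint _ _)] at h1
  simp_rw [mul_comm (A _ _), mul_comm (B _ _)] at h1
  unfold kconv
  linarith

lemma heatSemigroup_apply {B : R3 → R3} {p : ℝ≥0∞} (hp : 1 ≤ p) (hB : MemLp B p) {t : ℝ}
    (ht : 0 < t) (x : R3) (i : Fin 3) :
    heatSemigroup t B x i = kconv (heatKernel t) (fun y => B y i) x := by
  have hint : Integrable fun y => heatKernel t (x - y) • B y := by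
    have hm := (((gaussianDecay_heatKernel ht).memLp_sub le_rfl x).1).smul hB.1
    have hn : Integrable fun y => heatKernel t (x - y) * ‖B y‖ :=
      (gaussianDecay_heatKernel ht).integrable_sub_mul hp hB.norm x
    refine hn.mono' hm (ae_of_all _ fun y => ?_)
    rw [norm_smul, Real.norm_of_nonneg (heatKernel_pos ht _).le]
  have h := (EuclideanSpace.proj i : R3 →L[ℝ] ℝ).integral_comp_comm hint
  simp only [PiLp.proj_apply, PiLp.smul_apply, smul_eq_mul] at h
  exact h.symm

/-! ### Pointwise bounds for the heat flow of the curl and their optimization -/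

/-- The derivative falls on one half of the evolution, `∂ⱼ e^{2sΔ} = (∂ⱼ e^{sΔ}) e^{sΔ}`, leaving
`e^{sΔ} f` to be estimated in `L^∞`. -/
lemma kconv_heatKernelD_two_mul {f : R3 → ℝ} {p : ℝ≥0∞} (hp : 1 ≤ p) (hf : MemLp f p) (j : Fin 3)
    {s : ℝ} (hs : 0 < s) (x : R3) :
    kconv (heatKernelD j (2 * s)) f x =
      ∫ w, kconv (heatKernel s) f w * heatKernelD j s (x - w) := by
  have hu : Integrable fun w => heatKernelD j s (x - w) :=
    (integrable_comp_sub_left _ x).2 (integrable_heatKernelD j hs)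
  have hint := (gaussianDecay_heatKernel hs).integrable_prod hp hf hu
  symm
  calc ∫ w, kconv (heatKernel s) f w * heatKernelD j s (x - w)
      = ∫ w, ∫ y, heatKernel s (w - y) * f y * heatKernelD j s (x - w) := by
        simp_rw [kconv, integral_mul_const]
    _ = ∫ y, ∫ w, heatKernel s (w - y) * f y * heatKernelD j s (x - w) :=
        integral_integral_swap hint
    _ = ∫ y, heatKernelD j (2 * s) (x - y) * f y := by
        refine integral_congr_ae (ae_of_all _ fun y => ?_)
        simp only
        rw [← integral_heatKernelD_mul_heatKernel j hs, ← integral_mul_const,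
          ← integral_sub_left_eq_self _ volume x]
        congr 1
        ext w
        rw [sub_sub_cancel, show x - w - y = x - y - w by abel]
        ring

lemma lintegral_enorm_heatKernelD_le (j : Fin 3) {t : ℝ} (ht : 0 < t) (x : R3) :
    ∫⁻ y, ‖heatKernelD j t (x - y)‖ₑ ≤ ENNReal.ofReal (3 * t ^ (-(1 / 2) : ℝ)) := by
  rw [lintegral_sub_left_eq_self (fun y => ‖heatKernelD j t y‖ₑ) x]
  calc _ ≤ ∫⁻ y, ENNReal.ofReal (3 * t ^ (-(1 / 2) : ℝ)) *
        ENNReal.ofReal (heatKernel (2 * t) y) := by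
        refine lintegral_mono fun y => ?_
        rw [← ENNReal.ofReal_mul (by positivity), Real.enorm_eq_ofReal_abs]
        exact ENNReal.ofReal_le_ofReal (abs_heatKernelD_le j ht y)
    _ = _ := by
        rw [lintegral_const_mul' _ _ ENNReal.ofReal_ne_top, lintegral_heatKernel (by positivity),
          mul_one]

/-- The pointwise bound of `∂ⱼ e^{tΔ} B` by the Besov norm of `B`. -/
lemma enorm_kconv_heatKernelD_le_besov {B : R3 → R3} (hB : MemLp B (3 / 2)) (i j : Fin 3) {t : ℝ}
    (ht : 0 < t) (x : R3) : ‖kconv (heatKernelD j t) (fun y => B y i) x‖ₑ ≤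
      ENNReal.ofReal (9 * t ^ (-(3 / 2) : ℝ)) * heatBesovNorm B := by
  obtain ⟨s, rfl⟩ : ∃ s, t = 2 * s := ⟨t / 2, by ring⟩
  have hs : 0 < s := by linarith
  set N := eLpNorm (heatSemigroup s B) ∞ volume with hN
  have hNK : N ≤ ENNReal.ofReal s⁻¹ * heatBesovNorm B := by
    have h1 : ENNReal.ofReal s * N ≤ heatBesovNorm B := le_iSup₂_of_le s hs le_rfl
    calc N = ENNReal.ofReal s⁻¹ * (ENNReal.ofReal s * N) := by
          rw [← mul_assoc, ← ENNReal.ofReal_mul (by positivity), inv_mul_cancel₀ hs.ne',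
            ENNReal.ofReal_one, one_mul]
      _ ≤ _ := by gcongr
  have hNae : ∀ᵐ w, ‖kconv (heatKernel s) (fun y => B y i) w‖ₑ ≤ N := by
    filter_upwards [enorm_ae_le_eLpNormEssSup (heatSemigroup s B) volume] with w hw
    rw [← heatSemigroup_apply one_le_three_halves hB hs, hN, eLpNorm_exponent_top]
    refine le_trans ?_ hw
    rw [← ofReal_norm, ← ofReal_norm]
    exact ENNReal.ofReal_le_ofReal (PiLp.norm_apply_le _ i)
  rw [kconv_heatKernelD_two_mul one_le_three_halves (memLp_coord hB i) j hs]
  calc _ ≤ ∫⁻ w, ‖kconv (heatKernel s) (fun y => B y i) w‖ₑ * ‖heatKernelD j s (x - w)‖ₑ := by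
        refine (enorm_integral_le_lintegral_enorm _).trans_eq ?_
        simp_rw [enorm_mul]
    _ ≤ ∫⁻ w, N * ‖heatKernelD j s (x - w)‖ₑ := by
        refine lintegral_mono_ae ?_
        filter_upwards [hNae] with w hw
        gcongr
    _ = N * ∫⁻ w, ‖heatKernelD j s (x - w)‖ₑ := by
        refine lintegral_const_mul'' _ ?_
        exact ((gaussianDecay_heatKernelD j hs).memLp_sub le_rfl x).1.enorm
    _ ≤ (ENNReal.ofReal s⁻¹ * heatBesovNorm B) * ENNReal.ofReal (3 * s ^ (-(1 / 2) : ℝ)) := by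
        gcongr
        exact lintegral_enorm_heatKernelD_le j hs x
    _ = ENNReal.ofReal (3 * s ^ (-(3 / 2) : ℝ)) * heatBesovNorm B := by
        rw [mul_right_comm, ← ENNReal.ofReal_mul (by positivity)]
        congr 2
        have : s ^ (-(3 / 2) : ℝ) = s ^ (-(1 / 2) : ℝ) * s⁻¹ := by
          rw [← Real.rpow_neg_one s, ← Real.rpow_add hs]; norm_num
        rw [this]
        ring
    _ ≤ _ := by
        -- Returning from `s` to `t = 2 * s` costs `2^{3/2} ≤ 3`, whence `9 = 3 * 3`.
        gcongr ENNReal.ofReal ?_ * _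
        rw [Real.mul_rpow (by norm_num) hs.le, ← mul_assoc]
        gcongr
        have h2 : (2 : ℝ) ^ (3 / 2 : ℝ) * 2 ^ (-(3 / 2) : ℝ) = 1 := by
          rw [← Real.rpow_add (by norm_num)]; norm_num
        nlinarith [two_rpow_three_halves_le,
          Real.rpow_pos_of_pos (show (0 : ℝ) < 2 by norm_num) (-(3 / 2))]

/-- The pointwise bound of `∂ⱼ e^{tΔ} B` by the maximal function of `B`. -/
lemma enorm_kconv_heatKernelD_le_hlMaximal {B : R3 → R3} {f : R3 → ℝ≥0∞} (hf : Measurable f)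
    (hBf : ∀ᵐ y, ‖B y‖ₑ ≤ f y) (i j : Fin 3) {t : ℝ} (ht : 0 < t) (x : R3) :
    ‖kconv (heatKernelD j t) (fun y => B y i) x‖ₑ ≤
      ENNReal.ofReal (3 * t ^ (-(1 / 2) : ℝ)) * hlMaximal f x := by
  calc _ ≤ ∫⁻ y, ‖heatKernelD j t (x - y) * B y i‖ₑ := enorm_integral_le_lintegral_enorm _
    _ ≤ ∫⁻ y, ENNReal.ofReal (3 * t ^ (-(1 / 2) : ℝ)) *
        (ENNReal.ofReal (heatKernel (2 * t) (x - y)) * f y) := by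
        refine lintegral_mono_ae ?_
        filter_upwards [hBf] with y hy
        rw [enorm_mul, ← mul_assoc, ← ENNReal.ofReal_mul (by positivity),
          Real.enorm_eq_ofReal_abs (heatKernelD j t (x - y))]
        refine mul_le_mul' (ENNReal.ofReal_le_ofReal (abs_heatKernelD_le j ht _)) (le_trans ?_ hy)
        rw [← ofReal_norm, ← ofReal_norm]
        exact ENNReal.ofReal_le_ofReal (PiLp.norm_apply_le _ i)
    _ ≤ _ := by
        rw [lintegral_const_mul' _ _ ENNReal.ofReal_ne_top]
        gcongr
        exact lintegral_heatKernel_mul_le_hlMaximal hf (by positivity) x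

lemma setLIntegral_rpow_neg_half {τ : ℝ} (hτ : 0 < τ) :
    ∫⁻ t in Ioc 0 τ, ENNReal.ofReal (3 * t ^ (-(1 / 2) : ℝ)) =
      ENNReal.ofReal (6 * τ ^ (1 / 2 : ℝ)) := by
  have hint : IntegrableOn (fun t : ℝ => 3 * t ^ (-(1 / 2) : ℝ)) (Ioc 0 τ) := by
    have := intervalIntegral.intervalIntegrable_rpow' (a := 0) (b := τ)
      (r := (-(1 / 2) : ℝ)) (by norm_num)
    rw [intervalIntegrable_iff_integrableOn_Ioc_of_le hτ.le] at this
    exact this.const_mul 3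
  rw [← ofReal_integral_eq_lintegral_ofReal hint
    ((ae_restrict_iff' measurableSet_Ioc).2 (ae_of_all _ fun t ht =>
      mul_nonneg (by norm_num) (Real.rpow_nonneg ht.1.le _))),
    ← intervalIntegral.integral_of_le hτ.le, intervalIntegral.integral_const_mul,
    integral_rpow (Or.inl (by norm_num))]
  have e1 : ((-(1 / 2) : ℝ) + 1) = 1 / 2 := by norm_num
  rw [e1, Real.zero_rpow (by norm_num)]
  congr 1
  ring

lemma setLIntegral_rpow_neg_three_halves {τ : ℝ} (hτ : 0 < τ) :
    ∫⁻ t in Ioi τ, ENNReal.ofReal (9 * t ^ (-(3 / 2) : ℝ)) =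
      ENNReal.ofReal (18 * τ ^ (-(1 / 2) : ℝ)) := by
  have hint : IntegrableOn (fun t : ℝ => 9 * t ^ (-(3 / 2) : ℝ)) (Ioi τ) :=
    (integrableOn_Ioi_rpow_of_lt (by norm_num) hτ).const_mul 9
  rw [← ofReal_integral_eq_lintegral_ofReal hint
    ((ae_restrict_iff' measurableSet_Ioi).2 (ae_of_all _ fun t ht =>
      mul_nonneg (by norm_num) (Real.rpow_nonneg (hτ.trans ht).le _))),
    integral_const_mul, integral_Ioi_rpow_of_lt (by norm_num) hτ]
  have e1 : ((-(3 / 2) : ℝ) + 1) = -(1 / 2) := by norm_num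
  rw [e1]
  congr 1
  ring

/-- Optimization over the splitting time, as in Hedberg's inequality. -/
lemma lintegral_Ioi_le_geometric_mean {m K : ℝ≥0∞} {h : ℝ → ℝ≥0∞}
    (h1 : ∀ t, 0 < t → h t ≤ ENNReal.ofReal (3 * t ^ (-(1 / 2) : ℝ)) * m)
    (h2 : ∀ t, 0 < t → h t ≤ ENNReal.ofReal (9 * t ^ (-(3 / 2) : ℝ)) * K) :
    ∫⁻ t in Ioi (0 : ℝ), h t ≤ 24 * (m * K) ^ (1 / 2 : ℝ) := by
  -- The optimal time needs both factors positive and finite. If one vanishes, so does the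
  -- integrand; if the product is infinite, there is nothing to prove.
  rcases eq_or_ne m 0 with rfl | hm0
  · refine (setLIntegral_mono' measurableSet_Ioi h1).trans ?_
    simp
  rcases eq_or_ne K 0 with rfl | hK0
  · refine (setLIntegral_mono' measurableSet_Ioi h2).trans ?_
    simp
  rcases eq_or_ne (m * K) ⊤ with htop | hfin
  · simp [htop]
  have hmt : m ≠ ⊤ := fun h => hfin (by rw [h, ENNReal.top_mul hK0])
  have hKt : K ≠ ⊤ := fun h => hfin (by rw [h, ENNReal.mul_top hm0])
  obtain ⟨a, ha, rfl⟩ : ∃ a : ℝ, 0 < a ∧ m = ENNReal.ofReal (a ^ 2) := by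
    refine ⟨√m.toReal, Real.sqrt_pos.2 (ENNReal.toReal_pos hm0 hmt), ?_⟩
    rw [Real.sq_sqrt ENNReal.toReal_nonneg, ENNReal.ofReal_toReal hmt]
  obtain ⟨b, hb, rfl⟩ : ∃ b : ℝ, 0 < b ∧ K = ENNReal.ofReal (b ^ 2) := by
    refine ⟨√K.toReal, Real.sqrt_pos.2 (ENNReal.toReal_pos hK0 hKt), ?_⟩
    rw [Real.sq_sqrt ENNReal.toReal_nonneg, ENNReal.ofReal_toReal hKt]
  -- The splitting time `K / m` balances the two bounds up to constants; the pieces are `6ab` and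
  -- `18ab`.
  set τ : ℝ := (b / a) ^ 2 with hτdef
  have hτ : 0 < τ := by positivity
  have hτ1 : τ ^ (1 / 2 : ℝ) = b / a := by
    rw [hτdef, ← Real.sqrt_eq_rpow, Real.sqrt_sq (by positivity)]
  have hτ2 : τ ^ (-(1 / 2) : ℝ) = a / b := by
    rw [Real.rpow_neg hτ.le, hτ1, inv_div]
  have hsplit : Ioi (0 : ℝ) = Ioc 0 τ ∪ Ioi τ := (Ioc_union_Ioi_eq_Ioi hτ.le).symm
  rw [hsplit]
  refine (lintegral_union_le _ _ _).trans ?_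
  have i1 : ∫⁻ t in Ioc 0 τ, h t ≤ ENNReal.ofReal (6 * (b * a)) := by
    refine (setLIntegral_mono' measurableSet_Ioc fun t ht => h1 t ht.1).trans ?_
    rw [lintegral_mul_const' _ _ ENNReal.ofReal_ne_top, setLIntegral_rpow_neg_half hτ, hτ1,
      ← ENNReal.ofReal_mul (by positivity)]
    refine ENNReal.ofReal_le_ofReal (le_of_eq ?_)
    field_simp
  have i2 : ∫⁻ t in Ioi τ, h t ≤ ENNReal.ofReal (18 * (b * a)) := by
    refine (setLIntegral_mono' measurableSet_Ioi fun t ht => h2 t (hτ.trans ht)).trans ?_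
    rw [lintegral_mul_const' _ _ ENNReal.ofReal_ne_top, setLIntegral_rpow_neg_three_halves hτ, hτ2,
      ← ENNReal.ofReal_mul (by positivity)]
    refine ENNReal.ofReal_le_ofReal (le_of_eq ?_)
    field_simp
  refine (add_le_add i1 i2).trans_eq ?_
  rw [← ENNReal.ofReal_add (by positivity) (by positivity),
    ← ENNReal.ofReal_mul (by positivity), ENNReal.ofReal_rpow_of_nonneg (by positivity)
      (by norm_num), ← Real.sqrt_eq_rpow, ← mul_pow, Real.sqrt_sq (by positivity),
    show (24 : ℝ≥0∞) = ENNReal.ofReal 24 by simp, ← ENNReal.ofReal_mul (by norm_num)]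
  congr 1
  ring

/-! ### The curl part and its `L³` bound -/

/-- The divergence-free part of the heat flow of `A` between the times `ε` and `T`. -/
noncomputable def heatCurlPart (ε T : ℝ) (A : R3 → R3) (x : R3) : R3 :=
  heatSemigroup ε A x - heatSemigroup T A x - heatPotentialGrad ε T A x

section curlPart

variable {ε T : ℝ} {A B : R3 → R3}

/-- The heat equation integrated in time from `ε` to `T`. -/
lemma sum_timeIntegral_heatKernelDD (hε : 0 < ε) (hT : ε ≤ T) (z : R3) :
    ∑ j, timeIntegral ε T (heatKernelDD j j) z = heatKernel T z - heatKernel ε z := by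
  have hcont : ∀ j : Fin 3, ContinuousOn (fun t => heatKernelDD j j t z) (Icc ε T) := by
    intro j t ht
    have ht0 : 0 < t := hε.trans_le ht.1
    have h1 : ContinuousAt (fun t => heatKernel t z) t := (hasDerivAt_heatKernel ht0 z).continuousAt
    refine ContinuousAt.continuousWithinAt ?_
    unfold heatKernelDD
    refine ContinuousAt.mul (ContinuousAt.sub ?_ ?_) h1
    · exact continuousAt_const.div (by fun_prop) (by positivity)
    · exact continuousAt_const.div (by fun_prop) (by positivity)
  have hint : ∀ j : Fin 3, IntegrableOn (fun t => heatKernelDD j j t z) (Icc ε T) := fun j =>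
    (hcont j).integrableOn_Icc
  unfold timeIntegral
  rw [← integral_finsetSum _ fun j _ => hint j, integral_Icc_eq_integral_Ioc,
    ← intervalIntegral.integral_of_le hT]
  refine intervalIntegral.integral_eq_sub_of_hasDerivAt (f := fun t => heatKernel t z)
    (fun t ht => ?_) ?_
  · rw [uIcc_of_le hT] at ht
    exact hasDerivAt_heatKernel (hε.trans_le ht.1) z
  · refine ContinuousOn.intervalIntegrable ?_
    rw [uIcc_of_le hT]
    exact continuousOn_finsetSum _ fun j _ => hcont j

lemma heatSemigroup_sub_heatSemigroup (hε : 0 < ε) (hT : ε ≤ T) (hA : MemLp A 3) (x : R3)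
    (i : Fin 3) : heatSemigroup ε A x i - heatSemigroup T A x i =
      - ∑ j, kconv (timeIntegral ε T (heatKernelDD j j)) (fun y => A y i) x := by
  have hT0 : 0 < T := hε.trans_le hT
  rw [heatSemigroup_apply (by norm_num) hA hε, heatSemigroup_apply (by norm_num) hA hT0]
  unfold kconv
  rw [← integral_finsetSum _ fun j _ => (gaussianDecay_timeIntegral_heatKernelDD hε hT0 j
    j).integrable_sub_mul (by norm_num) (memLp_coord hA i) x]
  simp_rw [← Finset.sum_mul, sum_timeIntegral_heatKernelDD hε hT, sub_mul]
  rw [integral_sub ((gaussianDecay_heatKernel hT0).integrable_sub_mul (by norm_num)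
    (memLp_coord hA i) x) ((gaussianDecay_heatKernel hε).integrable_sub_mul (by norm_num)
    (memLp_coord hA i) x)]
  ring

/-- The curl part is expressed through the weak curl `B` alone. -/
lemma heatCurlPart_apply (hε : 0 < ε) (hT : ε ≤ T) (hA : MemLp A 3) (hB : MemLp B (3 / 2))
    (h : HasWeakCurl A B) (x : R3) (i : Fin 3) : heatCurlPart ε T A x i =
      ∫ t in Icc ε T, (kconv (heatKernelD (i + 1) t) (fun y => B y (i + 2)) x -
        kconv (heatKernelD (i + 2) t) (fun y => B y (i + 1)) x) := by
  have hT0 : 0 < T := hε.trans_le hT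
  have e1 : heatCurlPart ε T A x i =
      ∑ j, (kconv (timeIntegral ε T (heatKernelDD i j)) (fun y => A y j) x -
        kconv (timeIntegral ε T (heatKernelDD j j)) (fun y => A y i) x) := by
    have := heatSemigroup_sub_heatSemigroup hε hT hA x i
    simp only [heatCurlPart, heatPotentialGrad, PiLp.sub_apply, this, Finset.sum_sub_distrib]
    ring
  have e2 : ∀ a b l, kconv (timeIntegral ε T (heatKernelDD a b)) (fun y => A y l) x =
      ∫ t in Icc ε T, kconv (heatKernelDD a b t) (fun y => A y l) x ∧
      IntegrableOn (fun t => kconv (heatKernelDD a b t) (fun y => A y l) x) (Icc ε T) := by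
    intro a b l
    obtain ⟨C, hC⟩ := exists_abs_heatKernelDD_le (T := T) hε a b
    exact ⟨kconv_timeIntegral (measurable_heatKernelDD a b) (by positivity) hC (by norm_num)
      (memLp_coord hA l) x, integrableOn_kconv (measurable_heatKernelDD a b) (by positivity) hC
      (by norm_num) (memLp_coord hA l) x⟩
  have hint : ∀ j, Integrable (fun t => kconv (heatKernelDD i j t) (fun y => A y j) x -
      kconv (heatKernelDD j j t) (fun y => A y i) x) (volume.restrict (Icc ε T)) := fun j =>
    (e2 _ _ _).2.sub (e2 _ _ _).2
  have e3 : ∀ j, kconv (timeIntegral ε T (heatKernelDD i j)) (fun y => A y j) x -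
      kconv (timeIntegral ε T (heatKernelDD j j)) (fun y => A y i) x =
      ∫ t in Icc ε T, (kconv (heatKernelDD i j t) (fun y => A y j) x -
        kconv (heatKernelDD j j t) (fun y => A y i) x) := by
    intro j
    rw [integral_sub (e2 _ _ _).2 (e2 _ _ _).2, (e2 _ _ _).1, (e2 _ _ _).1]
  simp_rw [e1, e3]
  rw [← integral_finsetSum _ fun j _ => hint j]
  refine setIntegral_congr_fun measurableSet_Icc fun t ht => ?_
  have ht0 : 0 < t := hε.trans_le ht.1
  -- This is `curl curl = ∇ div - Δ` on kernels: the term `j = i` cancels, and the other two are the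
  -- two curl contributions, with indices modulo 3.
  simp only [kconv_heatKernelD_curl hA hB h _ _ ht0, Fin.sum_univ_three]
  fin_cases i <;> simp [show (1 : Fin 3) + 2 = 0 from rfl, show (2 : Fin 3) + 1 = 0 from rfl,
    show (2 : Fin 3) + 2 = 1 from rfl, show (1 : Fin 3) + 1 = 2 from rfl] <;> ring

lemma enorm_heatCurlPart_apply_le (hε : 0 < ε) (hT : ε ≤ T) (hA : MemLp A 3)
    (hB : MemLp B (3 / 2)) (h : HasWeakCurl A B) {f : R3 → ℝ≥0∞} (hf : Measurable f)
    (hBf : ∀ᵐ y, ‖B y‖ₑ ≤ f y) (x : R3) (i : Fin 3) :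
    ‖heatCurlPart ε T A x i‖ₑ ≤ 48 * (hlMaximal f x * heatBesovNorm B) ^ (1 / 2 : ℝ) := by
  have hsub : Icc ε T ⊆ Ioi 0 := fun t ht => hε.trans_le ht.1
  have hone : ∀ a b, IntegrableOn (fun t => kconv (heatKernelD a t) (fun y => B y b) x)
      (Icc ε T) := by
    intro a b
    have hT0 : 0 < T := hε.trans_le hT
    obtain ⟨C, hC⟩ := exists_abs_heatKernelD_le (T := T) hε a
    exact integrableOn_kconv (measurable_heatKernelD a) (by positivity) hC one_le_three_halves
      (memLp_coord hB b) x
  have hbd : ∀ a b, ∫⁻ t in Icc ε T, ‖kconv (heatKernelD a t) (fun y => B y b) x‖ₑ ≤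
      24 * (hlMaximal f x * heatBesovNorm B) ^ (1 / 2 : ℝ) := fun a b =>
    (lintegral_mono_set hsub).trans (lintegral_Ioi_le_geometric_mean
      (fun t ht => enorm_kconv_heatKernelD_le_hlMaximal hf hBf b a ht x)
      (fun t ht => enorm_kconv_heatKernelD_le_besov hB b a ht x))
  rw [heatCurlPart_apply hε hT hA hB h, integral_sub (hone _ _) (hone _ _)]
  refine (enorm_sub_le).trans ?_
  calc _ ≤ 24 * (hlMaximal f x * heatBesovNorm B) ^ (1 / 2 : ℝ) +
        24 * (hlMaximal f x * heatBesovNorm B) ^ (1 / 2 : ℝ) :=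
        add_le_add ((enorm_integral_le_lintegral_enorm _).trans (hbd _ _))
          ((enorm_integral_le_lintegral_enorm _).trans (hbd _ _))
    _ = _ := by rw [← add_mul]; norm_num

lemma norm_le_sum_abs (z : R3) : ‖z‖ ≤ ∑ i, |z i| := by
  have hz : z = ∑ i, z i • (EuclideanSpace.single i (1 : ℝ) : R3) := by
    ext j
    fin_cases j <;> simp [Fin.sum_univ_three]
  calc ‖z‖ = ‖∑ i, z i • (EuclideanSpace.single i (1 : ℝ) : R3)‖ := by rw [← hz]
    _ ≤ ∑ i, ‖z i • (EuclideanSpace.single i (1 : ℝ) : R3)‖ := norm_sum_le _ _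
    _ = _ := by simp [norm_smul]

lemma enorm_le_sum_enorm (z : R3) : ‖z‖ₑ ≤ ∑ i, ‖z i‖ₑ := by
  simp_rw [← ofReal_norm]
  rw [← ENNReal.ofReal_sum_of_nonneg fun i _ => norm_nonneg _]
  exact ENNReal.ofReal_le_ofReal (norm_le_sum_abs z)

lemma enorm_heatCurlPart_le (hε : 0 < ε) (hT : ε ≤ T) (hA : MemLp A 3)
    (hB : MemLp B (3 / 2)) (h : HasWeakCurl A B) {f : R3 → ℝ≥0∞} (hf : Measurable f)
    (hBf : ∀ᵐ y, ‖B y‖ₑ ≤ f y) (x : R3) :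
    ‖heatCurlPart ε T A x‖ₑ ≤ 144 * (hlMaximal f x * heatBesovNorm B) ^ (1 / 2 : ℝ) := by
  refine (enorm_le_sum_enorm _).trans ((Finset.sum_le_sum fun i _ =>
    enorm_heatCurlPart_apply_le hε hT hA hB h hf hBf x i).trans_eq ?_)
  rw [Finset.sum_const, Finset.card_univ, Fintype.card_fin, nsmul_eq_mul, ← mul_assoc]
  norm_num

lemma memLp_heatSemigroup (hA : MemLp A 3) {t : ℝ} (ht : 0 < t) : MemLp (heatSemigroup t A) 3 := by
  refine memLp_of_coord fun i => ?_
  simp_rw [heatSemigroup_apply (by norm_num) hA ht]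
  exact (gaussianDecay_heatKernel ht).memLp_kconv (memLp_coord hA i)

/-- Rules out the ambiguous product `0 * ⊤` on the right side of the `L³` bound. -/
lemma heatBesovNorm_eq_zero (hB : eLpNorm B (3 / 2) volume = 0)
    (hm : AEStronglyMeasurable B volume) :
    heatBesovNorm B = 0 := by
  have hB0 : B =ᵐ[volume] 0 :=
    (eLpNorm_eq_zero_iff hm (zero_lt_one.trans_le one_le_three_halves).ne').1 hB
  have hz : ∀ t, heatSemigroup t B = 0 := by
    intro t
    ext1 x
    unfold heatSemigroup
    refine integral_eq_zero_of_ae ?_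
    filter_upwards [hB0] with y hy
    simp [hy]
  simp [heatBesovNorm, hz]

lemma three_halves_toReal : (3 / 2 : ℝ≥0∞).toReal = 3 / 2 := by
  simp [ENNReal.toReal_div]

/-- The `L³` bound for the curl part. -/
lemma eLpNorm_heatCurlPart_le (hε : 0 < ε) (hT : ε ≤ T) (hA : MemLp A 3)
    (hB : MemLp B (3 / 2)) (h : HasWeakCurl A B) :
    eLpNorm (heatCurlPart ε T A) 3 volume ≤
      1440 * eLpNorm B (3 / 2) volume ^ (1 / 2 : ℝ) * heatBesovNorm B ^ (1 / 2 : ℝ) := by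
  obtain ⟨f, hf, hfB⟩ : ∃ f : R3 → ℝ≥0∞, Measurable f ∧ (fun y => ‖B y‖ₑ) =ᵐ[volume] f :=
    hB.1.enorm
  have hpt := enorm_heatCurlPart_le hε hT hA hB h hf hfB.le
  have hT0 : 0 < T := hε.trans_le hT
  rcases eq_or_ne (heatBesovNorm B) 0 with hK0 | hK0
  · have hz : heatCurlPart ε T A = 0 := by
      ext1 x
      have := hpt x
      rw [hK0, mul_zero, ENNReal.zero_rpow_of_pos (by norm_num), mul_zero] at this
      exact enorm_eq_zero.1 (le_antisymm this zero_le)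
    simp [hz]
  -- The Besov norm may be infinite; then the right side is `⊤` because `B` does not vanish.
  have hN0 : eLpNorm B (3 / 2) volume ≠ 0 := fun h0 => hK0 (heatBesovNorm_eq_zero h0 hB.1)
  rcases eq_or_ne (heatBesovNorm B) ⊤ with hKt | hKt
  · rw [hKt, ENNReal.top_rpow_of_pos (by norm_num), ENNReal.mul_top]
    · exact le_top
    · refine mul_ne_zero (by norm_num) ?_
      simp [hN0, hB.2.ne]
  set K := (heatBesovNorm B).toReal with hK
  have hKpos : 0 < K := ENNReal.toReal_pos hK0 hKt
  have hKe : heatBesovNorm B = ENNReal.ofReal K := (ENNReal.ofReal_toReal hKt).symm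
  have hUm : MemLp (heatCurlPart ε T A) 3 :=
    ((memLp_heatSemigroup hA hε).sub (memLp_heatSemigroup hA hT0)).sub
      (memLp_heatPotentialGrad hε hT0 hA)
  -- Squaring the pointwise bound puts `|U|² / (144² K)`, with `U` the curl part, below the maximal
  -- function; its power `3/2` is a multiple of `|U|³`.
  have hmax := lintegral_rpow_le_of_le_hlMaximal (f := f) hf
    (F := fun x => ‖heatCurlPart ε T A x‖ ^ 2 / (144 ^ 2 * K))
    ((hUm.1.norm.aemeasurable.pow_const 2).div_const _) (fun x => by positivity) (fun x => by
      rw [ENNReal.ofReal_div_of_pos (by positivity), ENNReal.div_le_iff (by simp [hKpos])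
        ENNReal.ofReal_ne_top]
      have h2 := ENNReal.rpow_le_rpow (hpt x) (show (0 : ℝ) ≤ 2 by norm_num)
      rw [ENNReal.mul_rpow_of_nonneg _ _ (by norm_num), ← ENNReal.rpow_mul,
        show (1 / 2 : ℝ) * 2 = 1 by norm_num, ENNReal.rpow_one, hKe, ← ofReal_norm,
        ENNReal.ofReal_rpow_of_nonneg (norm_nonneg _) (by norm_num), Real.rpow_two] at h2
      refine h2.trans_eq ?_
      rw [ENNReal.ofReal_mul (by positivity), mul_left_comm,
        show (144 : ℝ≥0∞) = ENNReal.ofReal 144 by simp,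
        ENNReal.ofReal_rpow_of_nonneg (by norm_num) (by norm_num), Real.rpow_two])
  have hcube : ∀ x, ‖heatCurlPart ε T A x‖ₑ ^ (3 : ℝ) =
      ENNReal.ofReal ((144 ^ 2 * K) ^ (3 / 2 : ℝ)) *
      ENNReal.ofReal ((‖heatCurlPart ε T A x‖ ^ 2 / (144 ^ 2 * K)) ^ (3 / 2 : ℝ)) := by
    intro x
    rw [← ENNReal.ofReal_mul (by positivity), ← Real.mul_rpow (by positivity) (by positivity),
      mul_div_cancel₀ _ (by positivity), ← ofReal_norm,
      ENNReal.ofReal_rpow_of_nonneg (norm_nonneg _) (by norm_num), ← Real.rpow_two,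
      ← Real.rpow_mul (norm_nonneg _)]
    norm_num
  have hBf : ∫⁻ x, f x ^ (3 / 2 : ℝ) = eLpNorm B (3 / 2) volume ^ (3 / 2 : ℝ) := by
    rw [eLpNorm_eq_lintegral_rpow_enorm_toReal (zero_lt_one.trans_le one_le_three_halves).ne'
      (ENNReal.div_ne_top (by simp) (by simp)), three_halves_toReal, ← ENNReal.rpow_mul]
    norm_num
    refine lintegral_congr_ae ?_
    filter_upwards [hfB] with x hx
    rw [← hx]
  rw [← ENNReal.rpow_le_rpow_iff (show (0 : ℝ) < 3 by norm_num), eLpNorm_three_rpow]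
  simp_rw [hcube]
  rw [lintegral_const_mul' _ _ ENNReal.ofReal_ne_top]
  refine (mul_le_mul_right hmax _).trans ?_
  rw [hBf, ENNReal.mul_rpow_of_nonneg _ _ (by norm_num), ENNReal.mul_rpow_of_nonneg _ _
    (by norm_num), ← ENNReal.rpow_mul, ← ENNReal.rpow_mul, hKe,
    show (1 / 2 : ℝ) * 3 = 3 / 2 by norm_num, Real.mul_rpow (by norm_num) hKpos.le,
    ENNReal.ofReal_mul (by positivity), ENNReal.ofReal_rpow_of_nonneg hKpos.le (by norm_num)]
  -- `144³ * 768 ≤ 1440³` because `768 ≤ 10³`.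
  have hc : ENNReal.ofReal ((144 ^ 2) ^ (3 / 2 : ℝ)) * 768 ≤ (1440 : ℝ≥0∞) ^ (3 : ℝ) := by
    rw [show (768 : ℝ≥0∞) = ENNReal.ofReal 768 by simp,
      show (1440 : ℝ≥0∞) = ENNReal.ofReal 1440 by simp, ← ENNReal.ofReal_mul (by positivity),
      ENNReal.ofReal_rpow_of_nonneg (by norm_num) (by norm_num)]
    refine ENNReal.ofReal_le_ofReal ?_
    rw [← Real.rpow_two, ← Real.rpow_mul (by norm_num)]
    norm_num
  calc _ = (ENNReal.ofReal ((144 ^ 2) ^ (3 / 2 : ℝ)) * 768) *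
        eLpNorm B (3 / 2) volume ^ (3 / 2 : ℝ) * ENNReal.ofReal (K ^ (3 / 2 : ℝ)) := by ring
    _ ≤ _ := by gcongr

end curlPart

/-! ### Passage to the limit and conclusion -/

lemma eLpNorm_le_sum_coord {G : R3 → R3} (hG : MemLp G 3) :
    eLpNorm G 3 volume ≤ ∑ i, eLpNorm (fun x => G x i) 3 volume := by
  calc eLpNorm G 3 volume ≤ eLpNorm (∑ i, fun x => ‖G x i‖) 3 volume := by
        refine eLpNorm_mono_real fun x => ?_
        rw [Finset.sum_apply]
        exact norm_le_sum_abs (G x)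
    _ ≤ ∑ i, eLpNorm (fun x => ‖G x i‖) 3 volume :=
        eLpNorm_sum_le (fun i _ => (memLp_coord hG i).1.norm) (by norm_num)
    _ = _ := by simp_rw [eLpNorm_norm]

lemma tendsto_eLpNorm_sub_heatSemigroup {A : R3 → R3} (hA : MemLp A 3) :
    Tendsto (fun t => eLpNorm (fun x => A x - heatSemigroup t A x) 3 volume) (𝓝[>] 0) (𝓝 0) := by
  have h := tendsto_finsetSum Finset.univ
    fun (i : Fin 3) _ => tendsto_eLpNorm_sub_heat_zero (memLp_coord hA i)
  rw [Finset.sum_const_zero] at h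
  refine tendsto_of_tendsto_of_tendsto_of_le_of_le' tendsto_const_nhds h
    (Eventually.of_forall fun _ => zero_le) ?_
  filter_upwards [self_mem_nhdsWithin] with t ht
  refine (eLpNorm_le_sum_coord (hA.sub (memLp_heatSemigroup hA ht))).trans_eq ?_
  simp_rw [Pi.sub_apply, PiLp.sub_apply, heatSemigroup_apply (by norm_num) hA ht]

lemma tendsto_eLpNorm_heatSemigroup_atTop {A : R3 → R3} (hA : MemLp A 3) :
    Tendsto (fun t => eLpNorm (heatSemigroup t A) 3 volume) atTop (𝓝 0) := by
  have h := tendsto_finsetSum Finset.univ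
    fun (i : Fin 3) _ => tendsto_eLpNorm_heat_atTop (memLp_coord hA i)
  rw [Finset.sum_const_zero] at h
  refine tendsto_of_tendsto_of_tendsto_of_le_of_le' tendsto_const_nhds h
    (Eventually.of_forall fun _ => zero_le) ?_
  filter_upwards [eventually_gt_atTop 0] with t ht
  refine (eLpNorm_le_sum_coord (memLp_heatSemigroup hA ht)).trans_eq ?_
  simp_rw [heatSemigroup_apply (by norm_num) hA ht]

/-- The heat potential is used as competitor: `A` minus its gradient is the sum of the initial-time
error, the flow at time `T` and the curl part. -/
lemma gaugeL3Seminorm_le {ε T : ℝ} (hε : 0 < ε) (hT : 0 < T) {A : R3 → R3} (hA : MemLp A 3) :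
    gaugeL3Seminorm A ≤ eLpNorm (fun x => A x - heatSemigroup ε A x) 3 volume +
      eLpNorm (heatSemigroup T A) 3 volume + eLpNorm (heatCurlPart ε T A) 3 volume := by
  have h1 := hA.sub (memLp_heatSemigroup hA hε)
  have h2 := memLp_heatSemigroup hA hT
  have h3 : MemLp (heatCurlPart ε T A) 3 :=
    ((memLp_heatSemigroup hA hε).sub h2).sub (memLp_heatPotentialGrad hε hT hA)
  calc gaugeL3Seminorm A ≤ eLpNorm (fun x => A x - heatPotentialGrad ε T A x) 3 volume :=
        iInf_le_of_le (heatPotential ε T A) (iInf_le_of_le (heatPotentialGrad ε T A)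
          (iInf_le_of_le (hasWeakGradient_heatPotential hε hT hA)
            (iInf_le_of_le (memLp_heatPotentialGrad hε hT hA) le_rfl)))
    _ = eLpNorm ((A - heatSemigroup ε A) + heatSemigroup T A + heatCurlPart ε T A) 3 volume := by
        congr 1
        ext1 x
        simp only [heatCurlPart, Pi.add_apply, Pi.sub_apply]
        abel
    _ ≤ _ := (eLpNorm_add_le (h1.add h2).1 h3.1 (by norm_num)).trans
        (add_le_add_left (eLpNorm_add_le h1.1 h2.1 (by norm_num)) _)

theorem proposition6 :
    ∃ C : ℝ≥0, ∀ A ∈ spaceY, ∀ B : R3 → R3, HasWeakCurl A B →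
      gaugeL3Seminorm A ≤
        C * eLpNorm B (3 / 2) volume ^ (1 / 2 : ℝ) * heatBesovNorm B ^ (1 / 2 : ℝ) := by
  refine ⟨1440, fun A hAY B hAB => ?_⟩
  obtain ⟨hA, B', hB', hAB'⟩ := hAY
  have hB : MemLp B (3 / 2) := hB'.ae_eq (hAB'.ae_eq hAB)
  set R : ℝ≥0∞ := ((1440 : ℝ≥0) : ℝ≥0∞) * eLpNorm B (3 / 2) volume ^ (1 / 2 : ℝ) *
    heatBesovNorm B ^ (1 / 2 : ℝ) with hR
  -- `R` depends on neither `ε` nor `T`, so `T → ∞` is taken first for fixed `ε`, and then `ε → 0`.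
  have hlarge : ∀ ε > 0, gaugeL3Seminorm A ≤
      eLpNorm (fun x => A x - heatSemigroup ε A x) 3 volume + R := by
    intro ε hε
    have hlim := ((tendsto_eLpNorm_heatSemigroup_atTop hA).const_add
      (eLpNorm (fun x => A x - heatSemigroup ε A x) 3 volume)).add_const R
    rw [add_zero] at hlim
    refine ge_of_tendsto hlim ?_
    filter_upwards [eventually_ge_atTop ε] with T hT
    refine (gaugeL3Seminorm_le hε (hε.trans_le hT) hA).trans ?_
    gcongr
    exact eLpNorm_heatCurlPart_le hε hT hA hB hAB
  have hlim := (tendsto_eLpNorm_sub_heatSemigroup hA).add_const R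
  rw [zero_add] at hlim
  refine ge_of_tendsto hlim ?_
  filter_upwards [self_mem_nhdsWithin] with ε hε using hlarge ε hε
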